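/- Let $(R,\mathfrak m)$ be a Henselian local domain and let $R^+$ be its absolute integral closure, i.e. the integral closure of $R$ in an algebraic closure of its field of fractions. Then $R^+$ is local; write $\mathfrak m_{R^+}$ for its maximal ideal. A torsion theory of modules over a ring $A$ is a Serre class $\mathfrak T$ of $A$-modules (closed under submodules, quotients and extensions, and containing $0$) that is closed under direct limits of directed systems. It gives the left exact functor $M\mapsto t(M)$, where $t(M)$ is the largest submodule of $M$ belonging to $\mathfrak T$. Write $\mathbf R^i\mathfrak T$ for its right derived functors, and let $cd(\mathfrak T)$ be the largest $i$ with $\mathbf R^i\mathfrak T\neq 0$ (the supremum of these $i$ in $\{-\infty\}\cup\mathbb N_0\cup\{\infty\}$). For an ideal $\mathfrak a$ of $A$ let $H^i_{\mathfrak a}(-)=\varinjlim_n \mathrm{Ext}^i_A(A/\mathfrak a^n,-)$. (i) Let $\mathcal{GR}$ be the torsion theory of the $R^+$-modules $M$ with $\mathfrak m_{R^+}M=0$. If $R$ is Noetherian and its residue field has prime characteristic, then $cd(\mathcal{GR})\le 2\dim R$. (ii) For $x\in R^+$ let $\mathfrak T_x$ be the torsion theory of the $R^+$-modules killed by $x^{1/n}$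 for arbitrarily large $n$, where $x^{1/n}$ is any element of $R^+$ whose $n$-th power is $x$. If $0\neq x\in\mathfrak m_{R^+}$, then $cd(\mathfrak T_x)=2$. (iii) Let $v:R^+\to\mathbb Q\cup\{\infty\}$ be a valuation (that is, $v(0)=\infty$, $v(1)=0$, $v(ab)=v(a)+v(b)$, $v(a+b)\ge\min\{v(a),v(b)\}$) that is nonnegative on $R^+$ and positive on $\mathfrak m_{R^+}$. Let $\mathfrak T_v$ be the torsion theory of the $R^+$-modules $M$ such that for all $m\in M$ and $\epsilon>0$ there is $a\in R^+$ with $v(a)<\epsilon$ and $am=0$, and let $\mathfrak F_v=\{\mathfrak a\trianglelefteq R^+: R^+/\mathfrak a\in\mathfrak T_v\}$, where $\mathfrak a$ precedes $\mathfrak b$ if $\mathfrak a\supseteq\mathfrak b$. Then, for every $i\ge 0$, there is an isomorphism of functors $\mathbf R^i\mathfrak T_v(-)\cong\varinjlim_{\mathfrak a\in\mathfrak F_v}H^i_{\mathfrak a}(-)$. In particular, $$cd(\mathfrak T_v)\le\sup\{\sup\{i\ge 0: H^i_{\mathfrak a}(-)\neq 0\}\mid \mathfrak a\in\mathfrak F_v\},$$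 where the supremum of the empty set is $-\infty$. -/

import Mathlib

open CategoryTheory CategoryTheory.Limits Opposite

universe u

noncomputable section

/-! ### Torsion theories, their functors, and cohomological dimension -/

/-- A (hereditary) torsion theory of `A`-modules: a Serre class of `A`-modules which is closed
under direct limits of directed systems. -/
structure TorsionTheory (A : Type u) [CommRing A] where
  /-- The class of modules. -/
  mem : ObjectProperty (ModuleCat.{u} A)
  isSerreClass : mem.IsSerreClass
  isClosedUnderDirectLimits : ∀ (J : Type u) [Preorder J] [IsDirectedOrder J] [Nonempty J],
    mem.IsClosedUnderColimitsOfShape J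

namespace TorsionTheory

variable {A : Type u} [CommRing A] (T : TorsionTheory A)

/-- The largest submodule `t(M)` of `M` that belongs to the torsion theory. -/
def torsion (M : ModuleCat.{u} A) : Submodule A M :=
  sSup {N : Submodule A M | T.mem (ModuleCat.of A N)}

lemma torsion_le_comap {M N : ModuleCat.{u} A} (f : M ⟶ N) :
    T.torsion M ≤ (T.torsion N).comap f.hom := by
  refine sSup_le fun P hP => ?_
  rw [← Submodule.map_le_iff_le_comap]
  refine le_sSup ?_
  have := T.isSerreClass
  have hs : Function.Surjective (f.hom.submoduleMap P) := f.hom.submoduleMap_surjective P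
  have : Epi (ModuleCat.ofHom (f.hom.submoduleMap P)) := (ModuleCat.epi_iff_surjective _).2 hs
  exact T.mem.prop_of_epi (ModuleCat.ofHom (f.hom.submoduleMap P)) hP

/-- The functor `M ↦ t(M)`; on morphisms it is the restriction. -/
def functor : ModuleCat.{u} A ⥤ ModuleCat.{u} A where
  obj M := ModuleCat.of A (T.torsion M)
  map f := ModuleCat.ofHom (f.hom.restrict (T.torsion_le_comap f))

instance : T.functor.Additive where

/-- The `i`-th right derived functor of the torsion functor. -/
def derived (i : ℕ) : ModuleCat.{u} A ⥤ ModuleCat.{u} A :=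
  T.functor.rightDerived i

/-- The Gabriel filtration of a torsion theory: the ideals `𝔞` with `A ⧸ 𝔞` torsion. -/
def gabriel : Set (Ideal A) :=
  {I | T.mem (ModuleCat.of A (A ⧸ I))}

end TorsionTheory

/-- The largest `i` for which the functor `H i` is nonzero: the supremum, taken in `WithBot ℕ∞`,
of the set of these `i` (it is `⊥` if all the functors vanish and `⊤` if there are nonzero ones
with arbitrarily large index). -/
def cohomologicalDimension {A : Type u} [CommRing A]
    (H : ℕ → (ModuleCat.{u} A ⥤ ModuleCat.{u} A)) : WithBot ℕ∞ :=
  sSup {d : WithBot ℕ∞ | ∃ i : ℕ, d = ((i : ℕ∞) : WithBot ℕ∞) ∧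
    ∃ M : ModuleCat.{u} A, ¬ IsZero ((H i).obj M)}

/-- The cohomological dimension of a torsion theory. -/
def TorsionTheory.cd {A : Type u} [CommRing A] (T : TorsionTheory A) : WithBot ℕ∞ :=
  cohomologicalDimension T.derived

/-! ### Local cohomology as a functor of the ideal -/

section LocalCohomology

variable {A : Type u} [CommRing A]

/-- For `I ≤ J`, the projections `A ⧸ I ^ n → A ⧸ J ^ n`. -/
def powQuotientMap {I J : Ideal A} (h : I ≤ J) :
    localCohomology.ringModIdeals (localCohomology.idealPowersDiagram I) ⟶
      localCohomology.ringModIdeals (localCohomology.idealPowersDiagram J) where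
  app n := ModuleCat.ofHom (Submodule.mapQ _ _ LinearMap.id (Ideal.pow_right_mono h (unop n)))
  naturality _ _ _ := by
    ext x
    obtain ⟨x, rfl⟩ := Submodule.Quotient.mk_surjective _ x
    rfl

/-- For `I ≤ J`, the natural map `colim Ext^i(A ⧸ J ^ n, -) ⟶ colim Ext^i(A ⧸ I ^ n, -)`. -/
def localCohomologyMap {I J : Ideal A} (h : I ≤ J) (i : ℕ) :
    localCohomology J i ⟶ localCohomology I i :=
  have := localCohomology.hasColimitDiagram.{u, 0} (localCohomology.idealPowersDiagram I) i
  have := localCohomology.hasColimitDiagram.{u, 0} (localCohomology.idealPowersDiagram J) i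
  colimMap (Functor.whiskerRight (NatTrans.op (powQuotientMap h)) (Ext A (ModuleCat.{u} A) i))

/-- Local cohomology `𝔞 ↦ H^i_𝔞(-) = colim Ext^i(A ⧸ 𝔞 ^ n, -)` as a functor of the ideal `𝔞`. -/
def localCohomologyFunctor (A : Type u) [CommRing A] (i : ℕ) :
    (Ideal A)ᵒᵖ ⥤ ModuleCat.{u} A ⥤ ModuleCat.{u} A where
  obj I := localCohomology I.unop i
  map f := localCohomologyMap f.unop.le i
  map_id I := by
    have := localCohomology.hasColimitDiagram.{u, 0}
      (localCohomology.idealPowersDiagram I.unop) i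
    refine colimit.hom_ext fun n => ?_
    refine (ι_colimMap _ n).trans ?_
    have h1 : (powQuotientMap (le_refl I.unop)) = 𝟙 _ := by
      ext n x
      obtain ⟨x, rfl⟩ := Submodule.Quotient.mk_surjective _ x
      rfl
    have h2 : (Functor.whiskerRight (NatTrans.op (powQuotientMap (le_refl I.unop)))
        (Ext A (ModuleCat.{u} A) i)).app n = 𝟙 _ := by
      rw [h1]
      exact (Ext A (ModuleCat.{u} A) i).map_id _
    erw [h2, Category.id_comp]
  map_comp {I J K} f g := by
    have := localCohomology.hasColimitDiagram.{u, 0}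
      (localCohomology.idealPowersDiagram I.unop) i
    have := localCohomology.hasColimitDiagram.{u, 0}
      (localCohomology.idealPowersDiagram J.unop) i
    have := localCohomology.hasColimitDiagram.{u, 0}
      (localCohomology.idealPowersDiagram K.unop) i
    have h1 : powQuotientMap (f ≫ g).unop.le =
        powQuotientMap g.unop.le ≫ powQuotientMap f.unop.le := by
      ext n x
      obtain ⟨x, rfl⟩ := Submodule.Quotient.mk_surjective _ x
      rfl
    have h2 : Functor.whiskerRight (NatTrans.op (powQuotientMap (f ≫ g).unop.le))
        (Ext A (ModuleCat.{u} A) i) =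
        Functor.whiskerRight (NatTrans.op (powQuotientMap f.unop.le)) _ ≫
        Functor.whiskerRight (NatTrans.op (powQuotientMap g.unop.le)) _ := by
      rw [h1]
      ext n : 2
      exact (Ext A (ModuleCat.{u} A) i).map_comp _ _
    unfold localCohomologyMap
    rw [h2]
    refine colimit.hom_ext fun n => ?_
    refine (ι_colimMap _ n).trans ?_
    symm
    refine (ι_colimMap_assoc _ n _).trans ?_
    refine (congrArg _ (ι_colimMap _ n)).trans ?_
    exact (Category.assoc _ _ _).symm

/-- The direct system of the functors `H^i_𝔞(-)`, where `𝔞` runs over the ideals in `F` and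
`𝔞` precedes `𝔟` if `𝔞 ⊇ 𝔟`. -/
def localCohomologySystem (F : Set (Ideal A)) (i : ℕ) :
    (↥F)ᵒᵖ ⥤ ModuleCat.{u} A ⥤ ModuleCat.{u} A :=
  (Subtype.mono_coe (· ∈ F)).functor.op ⋙ localCohomologyFunctor A i

end LocalCohomology

/-! ### A criterion for a class of modules to be a torsion theory -/

namespace TorsionTheory

variable {A : Type u} [CommRing A]

/-- A class of modules that is determined by a topologizing and idempotent filter of ideals
(membership of a module means that the annihilators of its elements lie in the filter) is a
torsion theory. -/
def ofFilter (P : ObjectProperty (ModuleCat.{u} A)) (F : Ideal A → Prop)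
    (hP : ∀ M : ModuleCat.{u} A, P M ↔ ∀ m : M, F (Ideal.torsionOf A M m))
    (htop : F ⊤) (hmono : ∀ I J : Ideal A, I ≤ J → F I → F J)
    (hext : ∀ I K : Ideal A, F I → (∀ a ∈ I, ∃ J, F J ∧ ∀ b ∈ J, b * a ∈ K) → F K) :
    TorsionTheory A where
  mem := P
  isSerreClass :=
    { exists_zero := ⟨ModuleCat.of A PUnit, ModuleCat.isZero_of_subsingleton _, (hP _).2 fun m =>
        hmono ⊤ _ (fun a _ => (Ideal.mem_torsionOf_iff _ _).2 (Subsingleton.elim _ _)) htop⟩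
      prop_of_mono := by
        intro X Y f hf hY
        have hinj := (ModuleCat.mono_iff_injective f).1 hf
        refine (hP X).2 fun m => hmono _ _ ?_ ((hP Y).1 hY (f.hom m))
        intro a ha
        rw [Ideal.mem_torsionOf_iff] at ha ⊢
        exact hinj ((f.hom.map_smul a m).trans (ha.trans (map_zero f.hom).symm))
      prop_of_epi := by
        intro X Y f hf hX
        have hsurj := (ModuleCat.epi_iff_surjective f).1 hf
        refine (hP Y).2 fun m => ?_
        obtain ⟨x, rfl⟩ := hsurj m
        refine hmono _ _ ?_ ((hP X).1 hX x)
        intro a ha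
        rw [Ideal.mem_torsionOf_iff] at ha ⊢
        exact (f.hom.map_smul a x).symm.trans ((congrArg f.hom ha).trans (map_zero _))
      prop_X₂_of_shortExact := by
        intro S hS h1 h3
        refine (hP _).2 fun m => ?_
        refine hext _ _ ((hP _).1 h3 (S.g.hom m)) fun a ha => ?_
        rw [Ideal.mem_torsionOf_iff] at ha
        obtain ⟨x, hx⟩ := (ShortComplex.moduleCat_exact_iff S).1 hS.exact (a • m)
          ((S.g.hom.map_smul a m).trans ha)
        refine ⟨_, (hP _).1 h1 x, fun b hb => ?_⟩
        rw [Ideal.mem_torsionOf_iff] at hb ⊢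
        rw [mul_smul, ← hx]
        exact (S.f.hom.map_smul b x).symm.trans ((congrArg S.f.hom hb).trans (map_zero _)) }
  isClosedUnderDirectLimits J _ _ _ :=
    { colimitsOfShape_le := by
        rintro X ⟨h⟩
        refine (hP X).2 fun m => ?_
        obtain ⟨j, y, hy⟩ := Concrete.isColimit_exists_rep _ h.isColimit m
        refine hmono _ _ ?_ ((hP _).1 (h.prop_diag_obj j) y)
        intro a ha
        rw [Ideal.mem_torsionOf_iff] at ha ⊢
        have := congrArg (h.ι.app j).hom ha
        rw [map_smul, map_zero] at this
        rw [← hy]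
        exact this }

end TorsionTheory

/-! ### The absolute integral closure -/

/-- The absolute integral closure `R⁺` of a domain `R`: its integral closure in an algebraic
closure of its field of fractions. -/
abbrev AbsoluteIntegralClosure (R : Type u) [CommRing R] [IsDomain R] : Type u :=
  integralClosure R (AlgebraicClosure (FractionRing R))

namespace AbsoluteIntegralClosure

variable {R : Type u} [CommRing R] [IsDomain R]

lemma exists_root (x : AbsoluteIntegralClosure R) {n : ℕ} (hn : 0 < n) :
    ∃ y : AbsoluteIntegralClosure R, y ^ n = x := by
  obtain ⟨z, hz⟩ := IsAlgClosed.exists_pow_nat_eq (x : AlgebraicClosure (FractionRing R)) hn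
  refine ⟨⟨z, IsIntegral.of_pow hn ?_⟩, Subtype.ext hz⟩
  rw [hz]
  exact x.2

lemma root_dvd_root {y z : AbsoluteIntegralClosure R} {k n : ℕ} (hk : 0 < k) (hkn : k ≤ n)
    (h : z ^ n = y ^ k) : z ∣ y := by
  by_cases hz : z = 0
  · subst hz
    rw [zero_pow (by omega)] at h
    rw [eq_zero_of_pow_eq_zero h.symm]
  have hz' : (z : AlgebraicClosure (FractionRing R)) ≠ 0 := fun h0 => hz (Subtype.ext h0)
  have hK : (z : AlgebraicClosure (FractionRing R)) ^ n =
      (y : AlgebraicClosure (FractionRing R)) ^ k := congrArg Subtype.val h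
  have hq : ((y : AlgebraicClosure (FractionRing R)) / z) ^ n =
      (y : AlgebraicClosure (FractionRing R)) ^ (n - k) := by
    rw [div_pow, div_eq_iff (pow_ne_zero _ hz'), hK, ← pow_add]
    congr 1
    omega
  refine ⟨⟨(y : AlgebraicClosure (FractionRing R)) / z,
    IsIntegral.of_pow (n := n) (by omega) ?_⟩, Subtype.ext ?_⟩
  · rw [hq]
    exact IsIntegral.pow y.2 _
  · exact (mul_div_cancel₀ _ hz').symm

end AbsoluteIntegralClosure

/-! ### Almost zero modules -/

section AlmostZero

variable (R : Type u) [CommRing R] [IsDomain R]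

/-- The torsion theory `GR` of the `R⁺`-modules that are killed by the maximal ideal of `R⁺`. -/
def torsionTheoryGR [IsLocalRing (AbsoluteIntegralClosure R)] :
    TorsionTheory (AbsoluteIntegralClosure R) :=
  TorsionTheory.ofFilter
    (fun M => ∀ a ∈ IsLocalRing.maximalIdeal (AbsoluteIntegralClosure R), ∀ m : M, a • m = 0)
    (fun I => IsLocalRing.maximalIdeal (AbsoluteIntegralClosure R) ≤ I)
    (fun M => ⟨fun h m a ha => (Ideal.mem_torsionOf_iff _ _).2 (h a ha m),
      fun h a ha m => (Ideal.mem_torsionOf_iff _ _).1 (h m ha)⟩)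
    le_top (fun _ _ hIJ hI => hI.trans hIJ)
    (by
      intro I K hI h a ha
      obtain ⟨b, hb⟩ := AbsoluteIntegralClosure.exists_root a two_pos
      have hbm : b ∈ IsLocalRing.maximalIdeal (AbsoluteIntegralClosure R) :=
        Ideal.IsPrime.mem_of_pow_mem inferInstance 2 (hb ▸ ha)
      obtain ⟨J, hJ, hJK⟩ := h b (hI hbm)
      rw [← hb, pow_two]
      exact hJK b (hJ hbm))

variable {R}

/-- The torsion theory `𝔗_x` of the `R⁺`-modules `M` such that `x ^ (1 / n)` kills `M` for
arbitrarily large `n`. Here `x ^ (1 / n)` is any `y` with `y ^ n = x`; such `y` exist and differ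
from each other by units only, so that it does not matter which one is taken. -/
def torsionTheoryOfElement (x : AbsoluteIntegralClosure R) :
    TorsionTheory (AbsoluteIntegralClosure R) :=
  TorsionTheory.ofFilter
    (fun M => ∀ N : ℕ, ∃ n : ℕ, N ≤ n ∧ 0 < n ∧ ∃ y : AbsoluteIntegralClosure R,
      y ^ n = x ∧ ∀ m : M, y • m = 0)
    (fun I => ∀ (n : ℕ) (y : AbsoluteIntegralClosure R), 0 < n → y ^ n = x → y ∈ I)
    (fun M => by
      constructor
      · intro h m k y hk hy
        obtain ⟨n, hkn, hn, z, hz, hzM⟩ := h k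
        obtain ⟨c, rfl⟩ := AbsoluteIntegralClosure.root_dvd_root hk hkn (hz.trans hy.symm)
        rw [Ideal.mem_torsionOf_iff, mul_comm, mul_smul, hzM, smul_zero]
      · intro h N
        obtain ⟨y, hy⟩ := AbsoluteIntegralClosure.exists_root x (Nat.succ_pos N)
        exact ⟨N + 1, Nat.le_succ N, Nat.succ_pos N, y, hy, fun m =>
          (Ideal.mem_torsionOf_iff _ _).1 (h m _ y (Nat.succ_pos N) hy)⟩)
    (fun _ _ _ _ => Submodule.mem_top) (fun _ _ hIJ hI n y hn hy => hIJ (hI n y hn hy))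
    (by
      intro I K hI h n y hn hy
      obtain ⟨w, hw⟩ := AbsoluteIntegralClosure.exists_root y two_pos
      have hw' : w ^ (2 * n) = x := by rw [pow_mul, hw, hy]
      obtain ⟨J, hJ, hJK⟩ := h w (hI (2 * n) w (by omega) hw')
      rw [← hw, pow_two]
      exact hJK w (hJ (2 * n) w (by omega) hw'))

/-- The torsion theory `𝔗_v` of the `R⁺`-modules `M` such that for all `m ∈ M` and all `ε > 0`
there is an `a ∈ R⁺` with `v a < ε` and `a • m = 0`. -/
def torsionTheoryOfValuation (v : AddValuation (AbsoluteIntegralClosure R) (WithTop ℚ)) :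
    TorsionTheory (AbsoluteIntegralClosure R) :=
  TorsionTheory.ofFilter
    (fun M => ∀ (m : M) (ε : ℚ), 0 < ε →
      ∃ a : AbsoluteIntegralClosure R, v a < (ε : WithTop ℚ) ∧ a • m = 0)
    (fun I => ∀ ε : ℚ, 0 < ε → ∃ a ∈ I, v a < (ε : WithTop ℚ))
    (fun M => by
      refine forall_congr' fun m => forall₂_congr fun ε _ => exists_congr fun a => ?_
      rw [Ideal.mem_torsionOf_iff, and_comm])
    (fun ε hε => ⟨1, Submodule.mem_top, by rw [v.map_one]; exact_mod_cast hε⟩)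
    (fun _ _ hIJ hI ε hε => (hI ε hε).imp fun _ h => ⟨hIJ h.1, h.2⟩)
    (by
      intro I K hI h ε hε
      obtain ⟨a, ha, hva⟩ := hI (ε / 2) (half_pos hε)
      obtain ⟨J, hJ, hJK⟩ := h a ha
      obtain ⟨b, hb, hvb⟩ := hJ (ε / 2) (half_pos hε)
      refine ⟨b * a, hJK b hb, ?_⟩
      rw [v.map_mul, ← add_halves ε, WithTop.coe_add]
      exact WithTop.add_lt_add hvb hva)

end AlmostZero

end

noncomputable section

/-! ### Integral extensions of Henselian local domains -/

section HenselianLocal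

open Polynomial

/-! Each torsion theory here is given by a filter `F` of ideals, closed under products: a module is
torsion iff the annihilators of its elements lie in `F`. An element of `t(X)` is the value at `1` of
a homomorphism `A ⧸ I → X` with `I` in `F`, so `t` is the direct limit of the functors `Hom(A ⧸ I,
-)`. Evaluating on an injective resolution, the derived functors of `t` are the direct limits of
`Ext^i(A ⧸ I, -)`: see `exists_extRightToDerived_eq` and `exists_map_eq_zero`. Since `F` contains
the powers of its members, these limits agree with those of local cohomology, which is (iii). If `F`
has a least element `I`, then the cohomological dimension is the projective dimension of `A ⧸ I`.

So (i) and (ii) are about projective dimensions. Both rest on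
`Ideal.hasProjectiveDimensionLT_quotient_sup_span_range`: if `J` is closed under `q`-th roots and `x
(n + 1) ^ q = x n`, then the kernel of `A ⧸ J → A ⧸ (J + (x 0, x 1, …))` is a sequential direct
limit of copies of `A ⧸ J`. The limit costs one dimension and passing to the quotient another. For
(ii) take `J = 0`. The value 2 is attained because the ideal of roots is idempotent, nonzero and
proper, while a projective ideal of a domain is finitely generated and a finitely generated
idempotent ideal of a domain is trivial.

For (i) let `p` be the residue characteristic. Adjoin the `p`-power roots of `p` (if `p ≠ 0`) and of
lifts of a system of parameters of `R ⧸ p`, at most `dim R` elements in all. Modulo `p` Frobenius is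
additive, so the ideals stay closed under `p`-th roots and hence radical. The last one is the
maximal ideal, the only prime containing all these elements.

That `R⁺` is local follows from Hensel's lemma, applied to the polynomial whose roots are the
products of `k` roots of a given one, with `k` chosen so that exactly one product avoids a given
maximal ideal. -/

lemma aeval_mem_range_of_isSymmetric {R B : Type*} [CommRing R] [CommRing B] [Algebra R B]
    {n : ℕ} {b : Fin n → B} {f : R[X]}
    (hf : f.map (algebraMap R B) = ∏ i, (X - C (b i)))
    {φ : MvPolynomial (Fin n) ℤ} (hφ : φ.IsSymmetric) :
    MvPolynomial.aeval b φ ∈ (algebraMap R B).range := by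
  -- Fundamental theorem of symmetric polynomials: `φ` is a polynomial in the elementary symmetric
  -- ones, whose values at `b` are up to sign the coefficients of `f`.
  obtain ⟨P, hP⟩ := MvPolynomial.esymmAlgHom_surjective (σ := Fin n) ℤ (n := n) (by simp)
    ⟨φ, hφ⟩
  have h1 : φ = MvPolynomial.aeval
      (fun i : Fin n => MvPolynomial.esymm (Fin n) ℤ (i + 1)) P := by
    have := congrArg Subtype.val hP
    rw [← MvPolynomial.esymmAlgHom_apply]
    exact this.symm
  have h2 : ∀ k, k ≤ n → MvPolynomial.aeval b (MvPolynomial.esymm (Fin n) ℤ k) ∈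
      (algebraMap R B).range := by
    intro k hk
    rw [MvPolynomial.aeval_esymm_eq_multiset_esymm]
    have h3 := Multiset.prod_X_sub_C_coeff (Multiset.map b Finset.univ.val) (k := n - k)
      (by simp)
    rw [Multiset.map_map] at h3
    change (∏ i, (X - C (b i))).coeff _ = _ at h3
    rw [← hf, coeff_map] at h3
    have hcard : (Multiset.map b Finset.univ.val).card = n := by simp
    rw [hcard, Nat.sub_sub_self hk] at h3
    refine ⟨(-1) ^ k * f.coeff (n - k), ?_⟩
    rw [map_mul, h3, ← mul_assoc, map_pow, map_neg, map_one, ← mul_pow]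
    simp
  rw [h1]
  clear h1 hP
  induction P using MvPolynomial.induction_on with
  | C a => exact ⟨(a : R), by simp⟩
  | add p q hp hq =>
    rw [map_add, map_add]
    exact add_mem hp hq
  | mul_X p i hp =>
    rw [map_mul, map_mul, MvPolynomial.aeval_X]
    exact mul_mem hp (h2 _ i.2)

/-- The monic polynomial whose roots are the products of `k` of the given elements. -/
def subsetProdPoly {B : Type*} [CommRing B] {n : ℕ} (k : ℕ) (b : Fin n → B) : B[X] :=
  ∏ I ∈ Finset.powersetCard k Finset.univ, (X - C (∏ i ∈ I, b i))

lemma subsetProdPoly_map {B D : Type*} [CommRing B] [CommRing D] {n : ℕ} (k : ℕ) (b : Fin n → B)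
    (φ : B →+* D) : (subsetProdPoly k b).map φ = subsetProdPoly k (φ ∘ b) := by
  simp [subsetProdPoly, Polynomial.map_prod]

lemma subsetProdPoly_comp_perm {B : Type*} [CommRing B] {n : ℕ} (k : ℕ) (b : Fin n → B)
    (e : Equiv.Perm (Fin n)) : subsetProdPoly k (b ∘ e) = subsetProdPoly k b := by
  refine Finset.prod_bij (fun I _ => I.map e.toEmbedding) ?_ ?_ ?_ ?_
  · intro I hI
    simpa [Finset.mem_powersetCard] using hI
  · intro I _ J _ h
    exact Finset.map_injective _ h
  · intro J hJ
    refine ⟨J.map e.symm.toEmbedding, by simpa [Finset.mem_powersetCard] using hJ, ?_⟩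
    ext x
    simp
  · intro I _
    simp

/-- For indeterminate roots, a permutation of the variables only permutes the linear factors. The
coefficients are therefore symmetric integer polynomials in the roots, so their values come from
`R`. -/
lemma exists_map_eq_subsetProdPoly {R B : Type*} [CommRing R] [CommRing B] [Nontrivial B] [Algebra R B]
    {n : ℕ} {b : Fin n → B} {f : R[X]}
    (hf : f.map (algebraMap R B) = ∏ i, (X - C (b i))) (k : ℕ) :
    ∃ g : R[X], g.Monic ∧ g.map (algebraMap R B) = subsetProdPoly k b := by
  have hmon : (subsetProdPoly k b).Monic := monic_prod_of_monic _ _ fun I _ => monic_X_sub_C _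
  have hl : subsetProdPoly k b ∈ lifts (algebraMap R B) := by
    rw [lifts_iff_coeff_lifts]
    intro j
    have h1 : subsetProdPoly k b = (subsetProdPoly k
        (MvPolynomial.X : Fin n → MvPolynomial (Fin n) ℤ)).map
          (MvPolynomial.aeval b).toRingHom := by
      rw [subsetProdPoly_map]
      congr 1
      ext i
      exact (MvPolynomial.aeval_X b i).symm
    rw [h1, coeff_map]
    refine aeval_mem_range_of_isSymmetric hf (φ := (subsetProdPoly k _).coeff j) ?_
    intro e
    have h2 := subsetProdPoly_map k (MvPolynomial.X : Fin n → MvPolynomial (Fin n) ℤ)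
      (MvPolynomial.rename e).toRingHom
    have h3 : ((MvPolynomial.rename e).toRingHom ∘
        (MvPolynomial.X : Fin n → MvPolynomial (Fin n) ℤ)) = MvPolynomial.X ∘ e := by
      ext1 i
      simp
    rw [h3, subsetProdPoly_comp_perm] at h2
    have h4 := congrArg (coeff · j) h2
    rw [coeff_map] at h4
    exact h4
  obtain ⟨g, hg, -, hgm⟩ := lifts_and_degree_eq_and_monic hl hmon
  exact ⟨g, hgm, hg⟩

lemma sum_subsetProd_mem_range {R B : Type*} [CommRing R] [CommRing B] [Algebra R B]
    {n : ℕ} {b : Fin n → B} {f : R[X]}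
    (hf : f.map (algebraMap R B) = ∏ i, (X - C (b i))) (k : ℕ) :
    ∃ a : R, algebraMap R B a = ∑ I ∈ Finset.powersetCard k Finset.univ, ∏ i ∈ I, b i := by
  have := aeval_mem_range_of_isSymmetric hf
    (MvPolynomial.esymm_isSymmetric (Fin n) ℤ k)
  simpa [MvPolynomial.esymm, map_sum, map_prod] using this

/-- An integral extension domain of a Henselian local ring, in which all monic polynomials with
coefficients in the base split, is local. -/
theorem HenselianLocalRing.isLocalRing_of_splits {R B : Type*} [CommRing R] [HenselianLocalRing R]
    [CommRing B] [IsDomain B] [Algebra R B] [Algebra.IsIntegral R B]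
    (hsplit : ∀ f : R[X], f.Monic → ∃ (n : ℕ) (b : Fin n → B),
      f.map (algebraMap R B) = ∏ i, (X - C (b i))) : IsLocalRing B := by
  have key : ∀ n₁ n₂ : Ideal B, n₁.IsMaximal → n₂.IsMaximal → n₁ ≤ n₂ := by
    intro n₁ n₂ h₁ h₂ y hy
    -- By integrality every maximal ideal of `B` contracts to that of `R`, so elements of `R` cannot
    -- separate `n₁` from `n₂`.
    have hc : ∀ n' : Ideal B, n'.IsMaximal → ∀ r : R,
        r ∈ IsLocalRing.maximalIdeal R ↔ algebraMap R B r ∈ n' := by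
      intro n' h' r
      have : (n'.comap (algebraMap R B)).IsMaximal :=
        Ideal.isMaximal_comap_of_isIntegral_of_isMaximal n'
      rw [← IsLocalRing.eq_maximalIdeal this]
      rfl
    obtain ⟨f, hfm, hfy⟩ := Algebra.IsIntegral.isIntegral (R := R) y
    obtain ⟨n, b, hf⟩ := hsplit f hfm
    classical
    -- `S` indexes the roots outside `n₂`, so the product over `S` is the only product of `S.card`
    -- roots outside `n₂`. The sum `a` of all such products is congruent to it modulo `n₂`, which
    -- makes `a` a simple root of `g` modulo the maximal ideal of `R`.
    let S : Finset (Fin n) := Finset.univ.filter fun i => b i ∉ n₂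
    have hS : S ∈ Finset.powersetCard S.card Finset.univ := by simp [Finset.mem_powersetCard]
    have hprod : ∀ I ∈ Finset.powersetCard S.card Finset.univ, ∏ i ∈ I, b i ∉ n₂ → I = S := by
      intro I hI hI2
      refine Finset.eq_of_subset_of_card_le ?_ (Finset.mem_powersetCard.1 hI).2.ge
      intro i hi
      refine Finset.mem_filter.2 ⟨Finset.mem_univ _, fun h => hI2 ?_⟩
      exact Ideal.mem_of_dvd _ (Finset.dvd_prod_of_mem b hi) h
    have hSprod : ∏ i ∈ S, b i ∉ n₂ := by
      intro h
      obtain ⟨i, hi, hi2⟩ := (h₂.isPrime.prod_mem_iff).1 h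
      exact (Finset.mem_filter.1 hi).2 hi2
    obtain ⟨g, hgm, hg⟩ := exists_map_eq_subsetProdPoly hf S.card
    obtain ⟨a, ha⟩ := sum_subsetProd_mem_range hf S.card
    have hsum : algebraMap R B a - ∏ i ∈ S, b i ∈ n₂ := by
      rw [ha, ← Finset.add_sum_erase _ _ hS, add_sub_cancel_left]
      refine n₂.sum_mem fun I hI => ?_
      by_contra h
      exact (Finset.mem_erase.1 hI).1 (hprod I (Finset.mem_erase.1 hI).2 h)
    have ha2 : algebraMap R B a ∉ n₂ := fun h => hSprod (by
      have := n₂.sub_mem h hsum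
      rwa [sub_sub_cancel] at this)
    have hfac : ∀ I ∈ (Finset.powersetCard S.card Finset.univ).erase S,
        algebraMap R B a - ∏ i ∈ I, b i ∉ n₂ := by
      intro I hI h
      have h3 : ∏ i ∈ I, b i ∈ n₂ := by
        by_contra h
        exact (Finset.mem_erase.1 hI).1 (hprod I (Finset.mem_erase.1 hI).2 h)
      exact ha2 (by simpa using n₂.add_mem h h3)
    have heval : ∀ r : R, algebraMap R B (g.eval r) =
        ∏ I ∈ Finset.powersetCard S.card Finset.univ, (algebraMap R B r - ∏ i ∈ I, b i) := by
      intro r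
      rw [← eval_map_apply, hg, subsetProdPoly, eval_prod]
      simp only [eval_sub, eval_X, eval_C]
    obtain ⟨β, hβ, hβa⟩ := HenselianLocalRing.is_henselian g hgm a
      (by
        rw [hc n₂ h₂, heval, ← Finset.mul_prod_erase _ _ hS]
        exact n₂.mul_mem_right _ hsum)
      (by
        by_contra hu
        have hu' : g.derivative.eval a ∈ IsLocalRing.maximalIdeal R :=
          (IsLocalRing.mem_maximalIdeal _).2 hu
        rw [hc n₂ h₂, ← eval_map_apply, ← derivative_map, hg, subsetProdPoly,
          ← Finset.mul_prod_erase _ _ hS, derivative_mul, eval_add, eval_mul, eval_mul] at hu'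
        have h4 : eval (algebraMap R B a) (X - C (∏ i ∈ S, b i)) = algebraMap R B a - ∏ i ∈ S, b i := by
          rw [eval_sub, eval_X, eval_C]
        rw [h4, derivative_X_sub_C, eval_one, one_mul] at hu'
        have h5 := (n₂.add_mem_iff_left (n₂.mul_mem_right _ hsum)).1 hu'
        rw [eval_prod, h₂.isPrime.prod_mem_iff] at h5
        obtain ⟨I, hI, h5⟩ := h5
        exact hfac I hI (by rwa [eval_sub, eval_X, eval_C] at h5))
    -- The Hensel root `β` is a unit and equals the product over some `I`. Being outside `n₂` forces
    -- `I = S`; being outside `n₁` puts every root indexed by `S` outside `n₁`. As `y ∈ n₁` is a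
    -- root, its index is not in `S`, that is, `y ∈ n₂`.
    have h6 := heval β
    rw [hβ.eq_zero, map_zero] at h6
    obtain ⟨I, hI, h7⟩ := Finset.prod_eq_zero_iff.1 h6.symm
    have hβm : β ∉ IsLocalRing.maximalIdeal R := by
      intro h
      refine ha2 ((hc n₂ h₂ a).1 ?_)
      have := (IsLocalRing.maximalIdeal R).sub_mem h hβa
      rwa [sub_sub_cancel] at this
    rw [sub_eq_zero] at h7
    have h8 : ∏ i ∈ I, b i ∉ n₂ := by rwa [← h7, ← hc n₂ h₂]
    have h9 : ∏ i ∈ I, b i ∉ n₁ := by rwa [← h7, ← hc n₁ h₁]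
    have hIS := hprod I hI h8
    have hy0 : ∏ i, (y - b i) = 0 := by
      have := congrArg (eval y) hf
      rw [Polynomial.eval_map, hfy, eval_prod] at this
      simpa using this.symm
    obtain ⟨i, -, hi⟩ := Finset.prod_eq_zero_iff.1 hy0
    rw [sub_eq_zero] at hi
    by_contra hy2
    refine h9 (Ideal.mem_of_dvd _ (Finset.dvd_prod_of_mem b (a := i) ?_) (hi ▸ hy))
    rw [hIS]
    exact Finset.mem_filter.2 ⟨Finset.mem_univ _, hi ▸ hy2⟩
  obtain ⟨M, hM⟩ := Ideal.exists_maximal B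
  exact IsLocalRing.of_unique_max_ideal ⟨M, hM, fun M' hM' =>
    le_antisymm (key _ _ hM' hM) (key _ _ hM hM')⟩

instance AbsoluteIntegralClosure.isLocalRing (R : Type u) [CommRing R] [IsDomain R]
    [HenselianLocalRing R] : IsLocalRing (AbsoluteIntegralClosure R) := by
  refine HenselianLocalRing.isLocalRing_of_splits (R := R) fun f hf => ?_
  let L := AlgebraicClosure (FractionRing R)
  have hs := (IsAlgClosed.splits (f.map (algebraMap R L))).eq_prod_roots_of_monic (hf.map _)
  obtain ⟨l, hl⟩ : ∃ l : List L, (f.map (algebraMap R L)).roots = Multiset.ofList l :=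
    ⟨_, (Multiset.coe_toList _).symm⟩
  have hint : ∀ i : Fin l.length, IsIntegral R l[i] := by
    intro i
    refine ⟨f, hf, ?_⟩
    have : l[i] ∈ (f.map (algebraMap R L)).roots := by
      rw [hl, Multiset.mem_coe]
      exact List.getElem_mem _
    have := (mem_roots'.1 this).2
    rwa [IsRoot, Polynomial.eval_map] at this
  refine ⟨l.length, fun i => ⟨l[i], hint i⟩, ?_⟩
  refine Polynomial.map_injective (algebraMap (AbsoluteIntegralClosure R) L)
    Subtype.val_injective ?_
  rw [Polynomial.map_map, ← IsScalarTower.algebraMap_eq, Polynomial.map_prod]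
  refine hs.trans ?_
  rw [hl, Multiset.map_coe, Multiset.prod_coe, ← Fin.prod_univ_fun_getElem l (fun a => X - C a)]
  refine Finset.prod_congr rfl fun i _ => ?_
  rw [Polynomial.map_sub, map_X, map_C]
  rfl

end HenselianLocal

/-! ### Homology classes in complexes of modules -/

section HomologyClasses

variable {A : Type u} [CommRing A] {ι : Type*} {c : ComplexShape ι}

/-- The class of a cycle in the homology of a complex of modules. -/
def homologyMk (K : HomologicalComplex (ModuleCat.{u} A) c) (i : ι) :
    LinearMap.ker (K.d i (c.next i)).hom →ₗ[A] K.homology i :=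
  ((K.sc i).moduleCatCyclesIso.inv ≫ K.homologyπ i).hom

lemma homologyMk_surjective (K : HomologicalComplex (ModuleCat.{u} A) c) (i : ι) :
    Function.Surjective (homologyMk K i) := by
  have h1 : Function.Surjective (K.homologyπ i) := (ModuleCat.epi_iff_surjective _).1
    (inferInstanceAs (Epi (K.sc i).homologyπ))
  exact h1.comp ((ModuleCat.epi_iff_surjective (K.sc i).moduleCatCyclesIso.inv).1 inferInstance)

lemma homologyMk_eq_zero_iff (K : HomologicalComplex (ModuleCat.{u} A) c) (i : ι)
    (z : LinearMap.ker (K.d i (c.next i)).hom) :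
    homologyMk K i z = 0 ↔ ∃ y : K.X (c.prev i), (K.d (c.prev i) i).hom y = z := by
  have h1 : homologyMk K i z = (K.sc i).moduleCatHomologyIso.inv
      ((LinearMap.range (K.sc i).moduleCatToCycles).mkQ z) :=
    congr($((K.sc i).moduleCatCyclesIso_inv_π).hom z)
  rw [h1]
  have h2 : Function.Injective (K.sc i).moduleCatHomologyIso.inv :=
    (ModuleCat.mono_iff_injective _).1 inferInstance
  refine (map_eq_zero_iff (K.sc i).moduleCatHomologyIso.inv.hom h2).trans ?_
  refine (Submodule.Quotient.mk_eq_zero _).trans ?_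
  constructor
  · rintro ⟨y, hy⟩
    exact ⟨y, congrArg Subtype.val hy⟩
  · rintro ⟨y, hy⟩
    exact ⟨y, Subtype.ext hy⟩

/-- Cycles inject into the complex, so the equality can be tested there. The representative `w` is
left free so that later uses may supply it in whatever form arises. -/
lemma homologyMap_homologyMk {K L : HomologicalComplex (ModuleCat.{u} A) c} (f : K ⟶ L) (i : ι)
    (z : LinearMap.ker (K.d i (c.next i)).hom) (w : LinearMap.ker (L.d i (c.next i)).hom)
    (hw : (w : L.X i) = (f.f i).hom z) :
    (HomologicalComplex.homologyMap f i).hom (homologyMk K i z) = homologyMk L i w := by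
  have h1 : (HomologicalComplex.cyclesMap f i).hom ((K.sc i).moduleCatCyclesIso.inv.hom z) =
      (L.sc i).moduleCatCyclesIso.inv.hom w := by
    have hinj : Function.Injective (L.iCycles i) :=
      (ModuleCat.mono_iff_injective _).1 inferInstance
    apply hinj
    have h2 : (L.iCycles i).hom ((L.sc i).moduleCatCyclesIso.inv.hom w) = w :=
      congr($((L.sc i).moduleCatCyclesIso_inv_iCycles).hom w)
    have h3 : (K.iCycles i).hom ((K.sc i).moduleCatCyclesIso.inv.hom z) = z :=
      congr($((K.sc i).moduleCatCyclesIso_inv_iCycles).hom z)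
    refine Eq.trans ?_ h2.symm
    refine congr($(HomologicalComplex.cyclesMap_i f i).hom
      ((K.sc i).moduleCatCyclesIso.inv.hom z)).trans ?_
    rw [hw]
    exact congrArg (f.f i).hom h3
  have h4 := congr($(HomologicalComplex.homologyπ_naturality f i).hom
    ((K.sc i).moduleCatCyclesIso.inv.hom z))
  refine h4.trans ?_
  exact congrArg (L.homologyπ i).hom h1

/-- Two surjective linear maps with the same kernel have isomorphic targets. -/
def LinearMap.equivOfKerEq {Z H E : Type*} [AddCommGroup Z] [AddCommGroup H] [AddCommGroup E]
    [Module A Z] [Module A H] [Module A E] (p : Z →ₗ[A] H) (q : Z →ₗ[A] E)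
    (hp : Function.Surjective p) (hq : Function.Surjective q)
    (h : LinearMap.ker p = LinearMap.ker q) : H ≃ₗ[A] E :=
  (p.quotKerEquivOfSurjective hp).symm ≪≫ₗ Submodule.quotEquivOfEq _ _ h ≪≫ₗ
    q.quotKerEquivOfSurjective hq

lemma LinearMap.equivOfKerEq_apply {Z H E : Type*} [AddCommGroup Z] [AddCommGroup H]
    [AddCommGroup E] [Module A Z] [Module A H] [Module A E] (p : Z →ₗ[A] H) (q : Z →ₗ[A] E)
    (hp : Function.Surjective p) (hq : Function.Surjective q)
    (h : LinearMap.ker p = LinearMap.ker q) (z : Z) :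
    LinearMap.equivOfKerEq p q hp hq h (p z) = q z := by
  have h1 : (p.quotKerEquivOfSurjective hp).symm (p z) = Submodule.Quotient.mk z := by
    rw [LinearEquiv.symm_apply_eq]
    rfl
  simp only [LinearMap.equivOfKerEq, LinearEquiv.trans_apply, h1]
  rfl

end HomologyClasses

/-! ### Right derived functors, in terms of cocycles -/

section RightDerived

variable {A : Type u} [CommRing A] (F G : ModuleCat.{u} A ⥤ ModuleCat.{u} A) [F.Additive]
  [G.Additive]

/-- The cocycles in degree `i` of the image of an injective resolution. -/
abbrev injCocycles {M : ModuleCat.{u} A} (I : InjectiveResolution M)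
    (i : ℕ) : Submodule A (F.obj (I.cocomplex.X i)) :=
  LinearMap.ker (F.map (I.cocomplex.d i ((ComplexShape.up ℕ).next i))).hom

/-- The class of a cocycle in a right derived functor. -/
def derivedMk {M : ModuleCat.{u} A} (I : InjectiveResolution M) (i : ℕ) :
    injCocycles F I i →ₗ[A] (F.rightDerived i).obj M :=
  (I.isoRightDerivedObj F i).inv.hom ∘ₗ
    homologyMk ((F.mapHomologicalComplex (ComplexShape.up ℕ)).obj I.cocomplex) i

lemma derivedMk_surjective {M : ModuleCat.{u} A} (I : InjectiveResolution M) (i : ℕ) :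
    Function.Surjective (derivedMk F I i) :=
  ((ModuleCat.epi_iff_surjective (I.isoRightDerivedObj F i).inv).1 inferInstance).comp
    (homologyMk_surjective _ i)

lemma derivedMk_eq_zero_iff {M : ModuleCat.{u} A} (I : InjectiveResolution M) (i : ℕ)
    (z : injCocycles F I i) :
    derivedMk F I i z = 0 ↔ ∃ y : F.obj (I.cocomplex.X ((ComplexShape.up ℕ).prev i)),
      (F.map (I.cocomplex.d ((ComplexShape.up ℕ).prev i) i)).hom y = z := by
  refine (map_eq_zero_iff (I.isoRightDerivedObj F i).inv.hom
    ((ModuleCat.mono_iff_injective _).1 inferInstance)).trans ?_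
  exact homologyMk_eq_zero_iff
    ((F.mapHomologicalComplex (ComplexShape.up ℕ)).obj I.cocomplex) i z

lemma rightDerived_map_derivedMk {M N : ModuleCat.{u} A} (f : M ⟶ N) (I : InjectiveResolution M)
    (J : InjectiveResolution N) (φ : InjectiveResolution.Hom I J f) (i : ℕ)
    (z : injCocycles F I i) (w : injCocycles F J i)
    (hw : (w : F.obj (J.cocomplex.X i)) = (F.map (φ.hom.f i)).hom z) :
    ((F.rightDerived i).map f).hom (derivedMk F I i z) = derivedMk F J i w := by
  have h1 := InjectiveResolution.isoRightDerivedObj_inv_naturality f I J φ.hom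
    φ.ι_f_zero_comp_hom_f_zero F i
  refine congr($(h1).hom (homologyMk _ i z)).trans ?_
  refine congrArg (J.isoRightDerivedObj F i).inv.hom ?_
  exact homologyMap_homologyMk ((F.mapHomologicalComplex (ComplexShape.up ℕ)).map φ.hom) i z w hw

variable {F G} in
lemma rightDerived_app_derivedMk (α : F ⟶ G) {M : ModuleCat.{u} A} (I : InjectiveResolution M)
    (i : ℕ) (z : injCocycles F I i) (w : injCocycles G I i)
    (hw : (w : G.obj (I.cocomplex.X i)) = (α.app _).hom z) :
    ((NatTrans.rightDerived α i).app M).hom (derivedMk F I i z) = derivedMk G I i w := by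
  have h1 : (I.isoRightDerivedObj F i).inv ≫ (NatTrans.rightDerived α i).app M =
      (HomologicalComplex.homologyFunctor _ (ComplexShape.up ℕ) i).map
        ((NatTrans.mapHomologicalComplex α _).app I.cocomplex) ≫
          (I.isoRightDerivedObj G i).inv := by
    rw [InjectiveResolution.rightDerived_app_eq α I i, Iso.inv_hom_id_assoc]
  refine congr($(h1).hom (homologyMk _ i z)).trans ?_
  refine congrArg (I.isoRightDerivedObj G i).inv.hom ?_
  exact homologyMap_homologyMk ((NatTrans.mapHomologicalComplex α _).app I.cocomplex) i z w hw

end RightDerived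

/-! ### The functors `Ext`, in terms of cocycles -/

section LeftDerived

variable {A : Type u} [CommRing A]

/-- `Ext` is a left derived functor of `Hom(-, M)` with values in the opposite category; its
homology has to be carried back compatibly with maps. -/
lemma homologyUnop_hom_naturality {c : ComplexShape ℕ}
    {K K' : HomologicalComplex (ModuleCat.{u} A)ᵒᵖ c} (a : K' ⟶ K) (i : ℕ) :
    (K.homologyUnop i).hom ≫ (HomologicalComplex.homologyMap a i).unop =
      HomologicalComplex.homologyMap ((HomologicalComplex.unopFunctor _ _).map a.op) i ≫
        (K'.homologyUnop i).hom :=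
  congrArg Quiver.Hom.unop (HomologicalComplex.homologyOp_hom_naturality
    ((HomologicalComplex.unopFunctor _ _).map a.op : K.unop ⟶ K'.unop) i)

/-- The cocycles in degree `i` of the complex of morphisms from a projective resolution. -/
abbrev projCocycles {N : ModuleCat.{u} A} (P : ProjectiveResolution N)
    (M : ModuleCat.{u} A) (i : ℕ) : Submodule A (P.complex.X i ⟶ M) :=
  LinearMap.ker (Linear.leftComp A M (P.complex.d ((ComplexShape.up ℕ).next i) i))

/-- The class of a cocycle in `Ext`. -/
def extClassMk {N : ModuleCat.{u} A} (P : ProjectiveResolution N)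
    (M : ModuleCat.{u} A) (i : ℕ) :
    projCocycles P M i →ₗ[A]
      ((Ext A (ModuleCat.{u} A) i).obj (op N)).obj M :=
  (P.isoExt i M).inv.hom ∘ₗ homologyMk (P.complex.linearYonedaObj A M) i

lemma extClassMk_surjective {N : ModuleCat.{u} A} (P : ProjectiveResolution N)
    (M : ModuleCat.{u} A) (i : ℕ) : Function.Surjective (extClassMk P M i) :=
  ((ModuleCat.epi_iff_surjective (P.isoExt i M).inv).1 inferInstance).comp
    (homologyMk_surjective _ i)

lemma extClassMk_eq_zero_iff {N : ModuleCat.{u} A} (P : ProjectiveResolution N)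
    (M : ModuleCat.{u} A) (i : ℕ) (z : projCocycles P M i) :
    extClassMk P M i z = 0 ↔ ∃ y : P.complex.X ((ComplexShape.up ℕ).prev i) ⟶ M,
      P.complex.d i ((ComplexShape.up ℕ).prev i) ≫ y = z := by
  refine (map_eq_zero_iff (P.isoExt (R := A) i M).inv.hom
    ((ModuleCat.mono_iff_injective _).1 inferInstance)).trans ?_
  exact homologyMk_eq_zero_iff (P.complex.linearYonedaObj A M) i z

lemma ext_map_extClassMk {N : ModuleCat.{u} A} (P : ProjectiveResolution N)
    {M M' : ModuleCat.{u} A} (g : M ⟶ M') (i : ℕ) (z : projCocycles P M i)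
    (w : projCocycles P M' i) (hw : (w : P.complex.X i ⟶ M') = z.1 ≫ g) :
    (((Ext A (ModuleCat.{u} A) i).obj (op N)).map g).hom (extClassMk P M i z) =
      extClassMk P M' i w := by
  let α := NatTrans.rightOp ((linearYoneda A (ModuleCat.{u} A)).map g)
  let K := (((linearYoneda A (ModuleCat.{u} A)).obj M).rightOp.mapHomologicalComplex
    (ComplexShape.down ℕ)).obj P.complex
  let K' := (((linearYoneda A (ModuleCat.{u} A)).obj M').rightOp.mapHomologicalComplex
    (ComplexShape.down ℕ)).obj P.complex
  let a : K' ⟶ K := (NatTrans.mapHomologicalComplex α (ComplexShape.down ℕ)).app P.complex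
  let a' : K.unop ⟶ K'.unop := (HomologicalComplex.unopFunctor _ _).map a.op
  have h1 : (P.isoExt i M).inv ≫ ((Ext A (ModuleCat.{u} A) i).obj (op N)).map g =
      HomologicalComplex.homologyMap a' i ≫ (P.isoExt (R := A) i M').inv := by
    have h2 := congrArg Quiver.Hom.unop (P.leftDerived_app_eq α i)
    have h3 := homologyUnop_hom_naturality a i
    have h4 : (P.isoLeftDerivedObj ((linearYoneda A (ModuleCat.{u} A)).obj M).rightOp i).hom.unop ≫
        ((Ext A (ModuleCat.{u} A) i).obj (op N)).map g =
        (HomologicalComplex.homologyMap a i).unop ≫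
        (P.isoLeftDerivedObj ((linearYoneda A (ModuleCat.{u} A)).obj M').rightOp i).hom.unop := by
      refine (congrArg (_ ≫ ·) h2).trans ?_
      rw [unop_comp, unop_comp, Category.assoc, ← unop_comp_assoc, Iso.inv_hom_id, unop_id,
        Category.id_comp]
      rfl
    refine (Category.assoc _ _ _).trans ((congrArg (_ ≫ ·) h4).trans ?_)
    refine (Category.assoc _ _ _).symm.trans ((congrArg (· ≫ _) h3).trans ?_)
    exact Category.assoc _ _ _
  refine congr($(h1).hom (homologyMk _ i z)).trans ?_
  refine congrArg (P.isoExt (R := A) i M').inv.hom ?_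
  exact homologyMap_homologyMk a' i z w hw

lemma ext_map_app_extClassMk {N N' : ModuleCat.{u} A} (f : N' ⟶ N) (P : ProjectiveResolution N)
    (P' : ProjectiveResolution N') (φ : ProjectiveResolution.Hom P' P f)
    (M : ModuleCat.{u} A) (i : ℕ) (z : projCocycles P M i)
    (w : projCocycles P' M i)
    (hw : (w : P'.complex.X i ⟶ M) = φ.hom.f i ≫ z.1) :
    (((Ext A (ModuleCat.{u} A) i).map f.op).app M).hom (extClassMk P M i z) =
      extClassMk P' M i w := by
  let F := ((linearYoneda A (ModuleCat.{u} A)).obj M).rightOp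
  let K := (F.mapHomologicalComplex (ComplexShape.down ℕ)).obj P.complex
  let K' := (F.mapHomologicalComplex (ComplexShape.down ℕ)).obj P'.complex
  let a : K' ⟶ K := (F.mapHomologicalComplex (ComplexShape.down ℕ)).map φ.hom
  let a' : K.unop ⟶ K'.unop := (HomologicalComplex.unopFunctor _ _).map a.op
  have h1 : (P.isoExt i M).inv ≫ ((Ext A (ModuleCat.{u} A) i).map f.op).app M =
      HomologicalComplex.homologyMap a' i ≫ (P'.isoExt (R := A) i M).inv := by
    have h2 := congrArg Quiver.Hom.unop
      (ProjectiveResolution.isoLeftDerivedObj_hom_naturality f P' P φ.hom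
        φ.hom_f_zero_comp_π_f_zero F i)
    have h3 := homologyUnop_hom_naturality a i
    refine (Category.assoc _ _ _).trans ((congrArg (_ ≫ ·) h2).trans ?_)
    refine (Category.assoc _ _ _).symm.trans ((congrArg (· ≫ _) h3).trans ?_)
    exact Category.assoc _ _ _
  refine congr($(h1).hom (homologyMk _ i z)).trans ?_
  refine congrArg (P'.isoExt (R := A) i M).inv.hom ?_
  exact homologyMap_homologyMk a' i z w hw

end LeftDerived

/-! ### Balancing `Ext` -/

section Balance

variable {A : Type u} [CommRing A]

lemma exists_injResolution_hom {M M' : ModuleCat.{u} A} (I : InjectiveResolution M)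
    (J : InjectiveResolution M') (f : M ⟶ M') : Nonempty (InjectiveResolution.Hom I J f) :=
  ⟨⟨InjectiveResolution.desc f J I, (InjectiveResolution.desc_commutes_zero f J I).trans (by simp)⟩⟩

lemma exists_projResolution_hom {N N' : ModuleCat.{u} A} (P : ProjectiveResolution N)
    (P' : ProjectiveResolution N') (f : N ⟶ N') : Nonempty (ProjectiveResolution.Hom P P' f) :=
  ⟨⟨ProjectiveResolution.lift f P P', (ProjectiveResolution.lift_commutes_zero f P P').trans (by simp)⟩⟩

/-- Stated with `prev` so that it matches the description of homology in every degree. In degree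
`0`, `prev` is `0` again with zero differential, and the right-hand side just says `f = 0`. -/
lemma injResolution_extMk_eq_zero_iff {N M : ModuleCat.{u} A} (I : InjectiveResolution M)
    (n : ℕ) (f : N ⟶ I.cocomplex.X n) (m : ℕ) (hm : n + 1 = m) (hf : f ≫ I.cocomplex.d n m = 0) :
    I.extMk f m hm hf = 0 ↔ ∃ g : N ⟶ I.cocomplex.X ((ComplexShape.up ℕ).prev n),
      g ≫ I.cocomplex.d _ n = f := by
  cases n with
  | succ p =>
    rw [I.extMk_eq_zero_iff f m hm hf p rfl]
    have : (ComplexShape.up ℕ).prev (p + 1) = p := by simp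
    rw [this]
  | zero =>
    have h0 : ∀ j, I.cocomplex.d j 0 = 0 := fun j => I.cocomplex.shape _ _ (by simp)
    constructor
    · intro h
      refine ⟨0, ?_⟩
      rw [zero_comp]
      -- A vanishing class is a coboundary from degree `-1`, where the complex extended to `ℤ` is
      -- zero.
      rw [← I.extEquivCohomologyClass.apply_eq_iff_eq, I.extEquivCohomologyClass_extMk,
        I.extEquivCohomologyClass_zero, CochainComplex.HomComplex.CohomologyClass.mk_eq_zero_iff,
        CochainComplex.HomComplex.Cocycle.fromSingleMk_mem_coboundaries_iff _ _ _ _ _ (-1)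
          (by simp)] at h
      obtain ⟨g, hg⟩ := h
      rw [(I.cochainComplex.isZero_of_isStrictlyGE 0 (-1) (by simp)).eq_of_tgt g 0, zero_comp] at hg
      exact (Preadditive.IsIso.comp_right_eq_zero f _).1 hg.symm |>.symm
    · rintro ⟨g, rfl⟩
      simp

lemma projResolution_extMk_eq_zero_iff {N M : ModuleCat.{u} A} (P : ProjectiveResolution N)
    (n : ℕ) (f : P.complex.X n ⟶ M) (m : ℕ) (hm : n + 1 = m) (hf : P.complex.d m n ≫ f = 0) :
    P.extMk f m hm hf = 0 ↔ ∃ g : P.complex.X ((ComplexShape.up ℕ).prev n) ⟶ M,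
      P.complex.d n _ ≫ g = f := by
  cases n with
  | succ p =>
    rw [P.extMk_eq_zero_iff f m hm hf p rfl]
    have : (ComplexShape.up ℕ).prev (p + 1) = p := by simp
    rw [this]
  | zero =>
    have h0 : ∀ j, P.complex.d 0 j = 0 := fun j => P.complex.shape _ _ (by simp)
    constructor
    · intro h
      refine ⟨0, ?_⟩
      rw [comp_zero]
      rw [← P.extEquivCohomologyClass.apply_eq_iff_eq, P.extEquivCohomologyClass_extMk,
        P.extEquivCohomologyClass_zero, CochainComplex.HomComplex.CohomologyClass.mk_eq_zero_iff,
        CochainComplex.HomComplex.Cocycle.toSingleMk_mem_coboundaries_iff _ _ _ _ _ 1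
          (by simp)] at h
      obtain ⟨g, hg⟩ := h
      rw [(P.cochainComplex.isZero_of_isStrictlyLE 0 1 (by simp)).eq_of_src g 0, comp_zero] at hg
      exact (Preadditive.IsIso.comp_left_eq_zero _ f).1 hg.symm |>.symm
    · rintro ⟨g, rfl⟩
      simp

/-- The functors `M ↦ Ext^i(N, M)`, defined by deriving in the second argument. -/
def extRight (A : Type u) [CommRing A] (i : ℕ) :
    (ModuleCat.{u} A)ᵒᵖ ⥤ ModuleCat.{u} A ⥤ ModuleCat.{u} A where
  obj N := ((linearCoyoneda A (ModuleCat.{u} A)).obj N).rightDerived i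
  map f := NatTrans.rightDerived ((linearCoyoneda A (ModuleCat.{u} A)).map f) i
  map_id N := by
    rw [CategoryTheory.Functor.map_id]
    exact NatTrans.rightDerived_id _ i
  map_comp f g := by
    rw [Functor.map_comp]
    exact NatTrans.rightDerived_comp _ _ i

/-- A cocycle with values in an injective resolution, as a morphism. -/
def injCocycleHom {N M : ModuleCat.{u} A} {I : InjectiveResolution M} {i : ℕ}
    (z : injCocycles ((linearCoyoneda A (ModuleCat.{u} A)).obj (op N)) I i) :
    N ⟶ I.cocomplex.X i := z.1

lemma injCocycleHom_comp_d {N M : ModuleCat.{u} A} {I : InjectiveResolution M} {i : ℕ}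
    (z : injCocycles ((linearCoyoneda A (ModuleCat.{u} A)).obj (op N)) I i) :
    injCocycleHom z ≫ I.cocomplex.d i ((ComplexShape.up ℕ).next i) = 0 := z.2

lemma projCocycles.d_comp {N M : ModuleCat.{u} A} {P : ProjectiveResolution N} {i : ℕ}
    (z : projCocycles P M i) :
    P.complex.d ((ComplexShape.up ℕ).next i) i ≫ z.1 = 0 := z.2

/-- The class in `Abelian.Ext` of a cocycle with values in an injective resolution. -/
def injExtMk {M : ModuleCat.{u} A} (I : InjectiveResolution M)
    (N : ModuleCat.{u} A) (i : ℕ) :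
    injCocycles ((linearCoyoneda A (ModuleCat.{u} A)).obj (op N)) I i →ₗ[A]
      Abelian.Ext N M i where
  toFun z := I.extMk (injCocycleHom z) _ (by simp) z.2
  map_add' z w := (I.add_extMk _ _ _ _ z.2 w.2).symm
  map_smul' r z := by
    have h := I.mk₀_comp_extMk (injCocycleHom z) ((ComplexShape.up ℕ).next i) (by simp) z.2
      (r • 𝟙 N)
    rw [Abelian.Ext.mk₀_smul, Abelian.Ext.smul_comp, Abelian.Ext.mk₀_id_comp] at h
    rw [RingHom.id_apply, h]
    congr 1
    exact (Linear.smul_comp _ _ _ r (𝟙 N) (injCocycleHom z)).trans ((by rw [Category.id_comp]; rfl)) |>.symm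

lemma injExtMk_surjective {M : ModuleCat.{u} A} (I : InjectiveResolution M)
    (N : ModuleCat.{u} A) (i : ℕ) : Function.Surjective (injExtMk I N i) := by
  intro α
  obtain ⟨f, hf, rfl⟩ := I.extMk_surjective α ((ComplexShape.up ℕ).next i) (by simp)
  exact ⟨⟨f, hf⟩, rfl⟩

/-- Both kernels are the coboundaries; this identifies the two quotients of the module of cocycles.
-/
lemma ker_injExtMk {M : ModuleCat.{u} A} (I : InjectiveResolution M)
    (N : ModuleCat.{u} A) (i : ℕ) : LinearMap.ker (derivedMk _ I i) =
      LinearMap.ker (injExtMk I N i) := by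
  ext z
  exact (derivedMk_eq_zero_iff _ I i z).trans (injResolution_extMk_eq_zero_iff I i _ _ (by simp)
    (injCocycleHom_comp_d z)).symm

/-- The class in `Abelian.Ext` of a cocycle on a projective resolution. -/
def projExtMk {N : ModuleCat.{u} A} (P : ProjectiveResolution N)
    (M : ModuleCat.{u} A) (i : ℕ) :
    projCocycles P M i →ₗ[A] Abelian.Ext N M i where
  toFun z := P.extMk z.1 _ (by simp) z.2
  map_add' z w := (P.add_extMk _ _ _ _ z.2 w.2).symm
  map_smul' r z := by
    have h := P.extMk_comp_mk₀ z.1 ((ComplexShape.up ℕ).next i) (by simp) z.2 (r • 𝟙 M)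
    rw [← Abelian.Ext.smul_eq_comp_mk₀] at h
    rw [RingHom.id_apply, h]
    congr 1

lemma projExtMk_surjective {N : ModuleCat.{u} A}
    (P : ProjectiveResolution N) (M : ModuleCat.{u} A) (i : ℕ) :
    Function.Surjective (projExtMk P M i) := by
  intro α
  obtain ⟨f, hf, rfl⟩ := P.extMk_surjective α ((ComplexShape.up ℕ).next i) (by simp)
  exact ⟨⟨f, hf⟩, rfl⟩

lemma ker_projExtMk {N : ModuleCat.{u} A}
    (P : ProjectiveResolution N) (M : ModuleCat.{u} A) (i : ℕ) :
    LinearMap.ker (extClassMk P M i) = LinearMap.ker (projExtMk P M i) := by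
  ext z
  exact (extClassMk_eq_zero_iff P M i z).trans
    (projResolution_extMk_eq_zero_iff P i _ _ (by simp) (projCocycles.d_comp z)).symm

/-- Deriving in the second argument gives `Abelian.Ext`. -/
def extRightEquiv (N M : ModuleCat.{u} A) (i : ℕ) :
    ((extRight A i).obj (op N)).obj M ≃ₗ[A] Abelian.Ext N M i :=
  LinearMap.equivOfKerEq (derivedMk _ (injectiveResolution M) i)
    (injExtMk (injectiveResolution M) N i) (derivedMk_surjective _ _ i)
    (injExtMk_surjective _ N i) (ker_injExtMk _ N i)

/-- Deriving in the first argument gives `Abelian.Ext`. -/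
def extLeftEquiv (N M : ModuleCat.{u} A) (i : ℕ) :
    ((Ext A (ModuleCat.{u} A) i).obj (op N)).obj M ≃ₗ[A] Abelian.Ext N M i :=
  LinearMap.equivOfKerEq (extClassMk (projectiveResolution N) M i)
    (projExtMk (projectiveResolution N) M i) (extClassMk_surjective _ M i)
    (projExtMk_surjective _ M i)
    (ker_projExtMk _ M i)

/-- Pushing a cocycle along a lift of `g` to the resolutions represents composition with `g`. Both
balancing equivalences turn functorial maps into the same compositions in `Abelian.Ext`, whence the
naturality of `extBalance`. -/
lemma extRightEquiv_map (N : ModuleCat.{u} A) {M M' : ModuleCat.{u} A} (g : M ⟶ M') (i : ℕ)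
    (x : ((extRight A i).obj (op N)).obj M) :
    extRightEquiv N M' i ((((extRight A i).obj (op N)).map g).hom x) =
      (extRightEquiv N M i x).comp (Abelian.Ext.mk₀ g) (add_zero i) := by
  obtain ⟨z, rfl⟩ := derivedMk_surjective _ (injectiveResolution M) i x
  obtain ⟨φ⟩ := exists_injResolution_hom (injectiveResolution M) (injectiveResolution M') g
  have hz : ((injCocycleHom z) ≫ φ.hom.f i) ≫
      (injectiveResolution M').cocomplex.d i ((ComplexShape.up ℕ).next i) = 0 := by
    rw [Category.assoc, φ.hom.comm, ← Category.assoc]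
    refine (congrArg (· ≫ _) (injCocycleHom_comp_d z)).trans zero_comp
  have h1 := rightDerived_map_derivedMk ((linearCoyoneda A (ModuleCat.{u} A)).obj (op N)) g
    _ _ φ i z ⟨_, hz⟩ rfl
  refine (congrArg (extRightEquiv N M' i) h1).trans ?_
  refine (LinearMap.equivOfKerEq_apply _ _ _ _ _ _).trans ?_
  refine Eq.trans ?_ (congrArg (fun e : Abelian.Ext N M i =>
    e.comp (Abelian.Ext.mk₀ g) (add_zero i)) (LinearMap.equivOfKerEq_apply _ _ _ _ _ z)).symm
  exact (InjectiveResolution.extMk_comp_mk₀ (injCocycleHom z) _ (by simp) z.2 φ).symm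

lemma extRightEquiv_map_app {N N' : ModuleCat.{u} A} (f : N' ⟶ N) (M : ModuleCat.{u} A) (i : ℕ)
    (x : ((extRight A i).obj (op N)).obj M) :
    extRightEquiv N' M i ((((extRight A i).map f.op).app M).hom x) =
      (Abelian.Ext.mk₀ f).comp (extRightEquiv N M i x) (zero_add i) := by
  obtain ⟨z, rfl⟩ := derivedMk_surjective _ (injectiveResolution M) i x
  have hz : (f ≫ (injCocycleHom z)) ≫
      (injectiveResolution M).cocomplex.d i ((ComplexShape.up ℕ).next i) = 0 := by
    rw [Category.assoc]
    refine (congrArg (_ ≫ ·) (injCocycleHom_comp_d z)).trans comp_zero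
  have h1 := rightDerived_app_derivedMk ((linearCoyoneda A (ModuleCat.{u} A)).map f.op)
    (injectiveResolution M) i z ⟨_, hz⟩ rfl
  refine (congrArg (extRightEquiv N' M i) h1).trans ?_
  refine (LinearMap.equivOfKerEq_apply _ _ _ _ _ _).trans ?_
  refine Eq.trans ?_ (congrArg (fun e : Abelian.Ext N M i =>
    (Abelian.Ext.mk₀ f).comp e (zero_add i)) (LinearMap.equivOfKerEq_apply _ _ _ _ _ z)).symm
  exact (InjectiveResolution.mk₀_comp_extMk _ (injCocycleHom z) _ (by simp) z.2 f).symm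

lemma extLeftEquiv_map (N : ModuleCat.{u} A) {M M' : ModuleCat.{u} A} (g : M ⟶ M') (i : ℕ)
    (x : ((Ext A (ModuleCat.{u} A) i).obj (op N)).obj M) :
    extLeftEquiv N M' i ((((Ext A (ModuleCat.{u} A) i).obj (op N)).map g).hom x) =
      (extLeftEquiv N M i x).comp (Abelian.Ext.mk₀ g) (add_zero i) := by
  obtain ⟨z, rfl⟩ := extClassMk_surjective (projectiveResolution N) M i x
  have hz : (projectiveResolution N).complex.d ((ComplexShape.up ℕ).next i) i ≫ z.1 ≫ g = 0 := by
    rw [← Category.assoc]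
    refine (congrArg (· ≫ _) (projCocycles.d_comp z)).trans zero_comp
  have h1 := ext_map_extClassMk (projectiveResolution N) g i z ⟨_, hz⟩ rfl
  refine (congrArg (extLeftEquiv N M' i) h1).trans ?_
  refine (LinearMap.equivOfKerEq_apply _ _ _ _ _ _).trans ?_
  refine Eq.trans ?_ (congrArg (fun e : Abelian.Ext N M i =>
    e.comp (Abelian.Ext.mk₀ g) (add_zero i)) (LinearMap.equivOfKerEq_apply _ _ _ _ _ z)).symm
  exact (ProjectiveResolution.extMk_comp_mk₀ _ z.1 _ (by simp) z.2 g).symm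

lemma extLeftEquiv_map_app {N N' : ModuleCat.{u} A} (f : N' ⟶ N) (M : ModuleCat.{u} A) (i : ℕ)
    (x : ((Ext A (ModuleCat.{u} A) i).obj (op N)).obj M) :
    extLeftEquiv N' M i ((((Ext A (ModuleCat.{u} A) i).map f.op).app M).hom x) =
      (Abelian.Ext.mk₀ f).comp (extLeftEquiv N M i x) (zero_add i) := by
  obtain ⟨z, rfl⟩ := extClassMk_surjective (projectiveResolution N) M i x
  obtain ⟨φ⟩ := exists_projResolution_hom (projectiveResolution N')
    (projectiveResolution N) f
  have hz : (projectiveResolution N').complex.d ((ComplexShape.up ℕ).next i) i ≫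
      φ.hom.f i ≫ z.1 = 0 := by
    rw [← φ.hom.comm_assoc]
    refine (congrArg (_ ≫ ·) (projCocycles.d_comp z)).trans comp_zero
  have h1 := ext_map_app_extClassMk f (projectiveResolution N) (projectiveResolution N') φ M i z
    ⟨_, hz⟩ rfl
  refine (congrArg (extLeftEquiv N' M i) h1).trans ?_
  refine (LinearMap.equivOfKerEq_apply _ _ _ _ _ _).trans ?_
  refine Eq.trans ?_ (congrArg (fun e : Abelian.Ext N M i =>
    (Abelian.Ext.mk₀ f).comp e (zero_add i)) (LinearMap.equivOfKerEq_apply _ _ _ _ _ z)).symm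
  exact (ProjectiveResolution.mk₀_comp_extMk z.1 _ (by simp) z.2 φ).symm

/-- `Ext` can be computed by deriving in either argument. -/
def extBalance (A : Type u) [CommRing A] (i : ℕ) :
    Ext A (ModuleCat.{u} A) i ≅ extRight A i :=
  NatIso.ofComponents (fun N => NatIso.ofComponents
    (fun M => ((extLeftEquiv N.unop M i).trans (extRightEquiv N.unop M i).symm).toModuleIso)
    (fun {M M'} g => by
      ext x
      apply (extRightEquiv N.unop M' i).injective
      refine (LinearEquiv.apply_symm_apply _ _).trans ((extLeftEquiv_map N.unop g i x).trans ?_)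
      refine Eq.trans ?_ (extRightEquiv_map N.unop g i _).symm
      congr 1
      exact (LinearEquiv.apply_symm_apply _ _).symm))
    (fun {N N'} f => by
      ext M x
      apply (extRightEquiv N'.unop M i).injective
      refine (LinearEquiv.apply_symm_apply _ _).trans
        ((extLeftEquiv_map_app f.unop M i x).trans ?_)
      refine Eq.trans ?_ (extRightEquiv_map_app f.unop M i _).symm
      congr 1
      exact (LinearEquiv.apply_symm_apply _ _).symm)

end Balance

/-! ### Derived functors of torsion theories -/

namespace TorsionTheory

variable {A : Type u} [CommRing A] (T : TorsionTheory A)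

/-- A torsion theory is defined by a filter of ideals if a module is torsion if and only if the
annihilators of its elements lie in the filter. -/
structure IsDefinedBy (F : Ideal A → Prop) : Prop where
  mem_iff : ∀ M : ModuleCat.{u} A, T.mem M ↔ ∀ m : M, F (Ideal.torsionOf A M m)
  top : F ⊤
  mono : ∀ {I J : Ideal A}, I ≤ J → F I → F J
  mul : ∀ {I J : Ideal A}, F I → F J → F (I * J)

lemma ofFilter_isDefinedBy (P : ObjectProperty (ModuleCat.{u} A)) (F : Ideal A → Prop)
    (hP : ∀ M : ModuleCat.{u} A, P M ↔ ∀ m : M, F (Ideal.torsionOf A M m))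
    (htop : F ⊤) (hmono : ∀ I J : Ideal A, I ≤ J → F I → F J)
    (hext : ∀ I K : Ideal A, F I → (∀ a ∈ I, ∃ J, F J ∧ ∀ b ∈ J, b * a ∈ K) → F K) :
    (ofFilter P F hP htop hmono hext).IsDefinedBy F where
  mem_iff := hP
  top := htop
  mono := hmono _ _
  mul {I J} hI hJ := hext I _ hI fun a ha => ⟨J, hJ, fun b hb => mul_comm a b ▸ Ideal.mul_mem_mul ha hb⟩

namespace IsDefinedBy

variable {T} {F : Ideal A → Prop}

lemma inf (hT : T.IsDefinedBy F) {I J : Ideal A} (hI : F I) (hJ : F J) : F (I ⊓ J) :=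
  hT.mono Ideal.mul_le_inf (hT.mul hI hJ)

lemma pow (hT : T.IsDefinedBy F) {I : Ideal A} (hI : F I) (n : ℕ) : F (I ^ n) := by
  induction n with
  | zero => rw [pow_zero, Ideal.one_eq_top]; exact hT.top
  | succ n ih => rw [pow_succ]; exact hT.mul ih hI

/-- The elements with annihilator in `F` form a submodule because `F` is closed under intersections,
and it contains every torsion submodule. Conversely, such an element generates a torsion submodule.
-/
lemma mem_torsion_iff (hT : T.IsDefinedBy F) (M : ModuleCat.{u} A) (m : M) :
    m ∈ T.torsion M ↔ F (Ideal.torsionOf A M m) := by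
  constructor
  · intro hm
    let t : Submodule A M :=
      { carrier := {m | F (Ideal.torsionOf A M m)}
        zero_mem' := by
          refine hT.mono ?_ hT.top
          intro a _
          rw [Ideal.mem_torsionOf_iff, smul_zero]
        add_mem' := by
          intro x y hx hy
          refine hT.mono ?_ (hT.inf hx hy)
          rintro a ⟨h1, h2⟩
          rw [SetLike.mem_coe, Ideal.mem_torsionOf_iff] at h1 h2
          rw [Ideal.mem_torsionOf_iff, smul_add, h1, h2, add_zero]
        smul_mem' := by
          intro c x hx
          refine hT.mono ?_ hx
          intro a ha
          rw [Ideal.mem_torsionOf_iff] at ha ⊢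
          rw [smul_comm, ha, smul_zero] }
    have : T.torsion M ≤ t := by
      refine sSup_le fun N hN x hx => ?_
      refine hT.mono ?_ ((hT.mem_iff _).1 hN ⟨x, hx⟩)
      intro a ha
      exact congrArg Subtype.val ha
    exact this hm
  · intro hm
    refine (le_sSup ?_ : Submodule.span A {m} ≤ T.torsion M) (Submodule.mem_span_singleton_self m)
    refine (hT.mem_iff _).2 ?_
    rintro ⟨x, hx⟩
    obtain ⟨c, rfl⟩ := Submodule.mem_span_singleton.1 hx
    refine hT.mono ?_ hm
    intro a ha
    rw [Ideal.mem_torsionOf_iff] at ha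
    refine Subtype.ext ?_
    change a • c • m = 0
    rw [smul_comm, ha, smul_zero]

lemma mem_gabriel_iff (hT : T.IsDefinedBy F) (I : Ideal A) : I ∈ T.gabriel ↔ F I := by
  refine (hT.mem_iff _).trans ⟨fun h => hT.mono ?_ (h (Submodule.Quotient.mk 1)), fun h m => ?_⟩
  · intro a ha
    have : Submodule.Quotient.mk (p := I) (a • (1 : A)) = 0 := ha
    rwa [Submodule.Quotient.mk_eq_zero, smul_eq_mul, mul_one] at this
  · obtain ⟨x, rfl⟩ := Submodule.Quotient.mk_surjective _ m
    refine hT.mono ?_ h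
    intro a ha
    change Submodule.Quotient.mk (p := I) (a • x) = 0
    rw [Submodule.Quotient.mk_eq_zero]
    exact I.mul_mem_right _ ha

lemma apply_one_mem_torsion (hT : T.IsDefinedBy F) {I : Ideal A} (hI : F I) (X : ModuleCat.{u} A)
    (f : ModuleCat.of A (A ⧸ I) ⟶ X) : f.hom (Submodule.Quotient.mk 1) ∈ T.torsion X := by
  rw [hT.mem_torsion_iff]
  refine hT.mono ?_ hI
  intro a ha
  rw [Ideal.mem_torsionOf_iff, ← map_smul, ← Submodule.Quotient.mk_smul, smul_eq_mul, mul_one,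
    (Submodule.Quotient.mk_eq_zero I).2 ha, map_zero]

/-- Evaluation at `1` of the morphisms from a cyclic torsion module. -/
def evalOne (hT : T.IsDefinedBy F) {I : Ideal A} (hI : F I) :
    (linearCoyoneda A (ModuleCat.{u} A)).obj (op (ModuleCat.of A (A ⧸ I))) ⟶ T.functor where
  app X := ModuleCat.ofHom
    { toFun f := ⟨(show ModuleCat.of A (A ⧸ I) ⟶ X from f).hom (Submodule.Quotient.mk 1),
        hT.apply_one_mem_torsion hI X f⟩
      map_add' _ _ := rfl
      map_smul' _ _ := rfl }
  naturality _ _ _ := rfl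

end IsDefinedBy

/-- For `I ≤ J`, the projection `A ⧸ I → A ⧸ J`. -/
abbrev quotientMap {I J : Ideal A} (h : I ≤ J) :
    ModuleCat.of A (A ⧸ I) ⟶ ModuleCat.of A (A ⧸ J) :=
  ModuleCat.ofHom (Submodule.mapQ I J LinearMap.id h)

namespace IsDefinedBy

variable {T} {F : Ideal A → Prop}

/-- The natural map from `Ext^i(A ⧸ I, -)` to the derived functors of the torsion functor. -/
def extRightToDerived (hT : T.IsDefinedBy F) {I : Ideal A} (hI : F I) (i : ℕ) :
    (extRight A i).obj (op (ModuleCat.of A (A ⧸ I))) ⟶ T.derived i :=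
  NatTrans.rightDerived (hT.evalOne hI) i

lemma map_comp_extRightToDerived (hT : T.IsDefinedBy F) {I J : Ideal A} (h : I ≤ J) (hI : F I) (hJ : F J) (i : ℕ) :
    (extRight A i).map (quotientMap h).op ≫ hT.extRightToDerived hI i =
      hT.extRightToDerived hJ i :=
  (NatTrans.rightDerived_comp _ _ i).symm

/-- The morphism from `A ⧸ I` to `X` given by an element killed by `I`. -/
abbrev quotientHom {I : Ideal A} {X : ModuleCat.{u} A} (x : X) (h : I ≤ Ideal.torsionOf A X x) :
    ModuleCat.of A (A ⧸ I) ⟶ X :=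
  ModuleCat.ofHom (I.liftQ (LinearMap.toSpanSingleton A X x) h)

lemma quotientHom_one {I : Ideal A} {X : ModuleCat.{u} A} (x : X)
    (h : I ≤ Ideal.torsionOf A X x) : (quotientHom x h).hom (Submodule.Quotient.mk 1) = x :=
  one_smul A x

lemma quotient_hom_ext {I : Ideal A} {X : ModuleCat.{u} A} {f g : ModuleCat.of A (A ⧸ I) ⟶ X}
    (h : f.hom (Submodule.Quotient.mk 1) = g.hom (Submodule.Quotient.mk 1)) : f = g := by
  refine ModuleCat.hom_ext (LinearMap.ext fun x => ?_)
  obtain ⟨x, rfl⟩ := Submodule.Quotient.mk_surjective _ x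
  have h1 : (Submodule.Quotient.mk x : A ⧸ I) = x • (Submodule.Quotient.mk 1 : A ⧸ I) := by
    rw [← Submodule.Quotient.mk_smul, smul_eq_mul, mul_one]
  rw [h1, map_smul, map_smul]
  exact congrArg (x • ·) h

/-- A cocycle is a single element with annihilator in `F`, hence the value at `1` of a homomorphism
from `A ⧸ K` for any `K` in `F` inside that annihilator. The freedom in `K` allows a least ideal or
a power to be taken later. -/
lemma exists_extRightToDerived_eq (hT : T.IsDefinedBy F) (i : ℕ) (M : ModuleCat.{u} A) (x : (T.derived i).obj M) :
    ∃ I, F I ∧ ∀ (K : Ideal A) (hK : F K), K ≤ I →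
      ∃ y, ((hT.extRightToDerived hK i).app M).hom y = x := by
  obtain ⟨z, rfl⟩ := derivedMk_surjective T.functor (injectiveResolution M) i x
  let z' : T.torsion ((injectiveResolution M).cocomplex.X i) := z.1
  refine ⟨_, (hT.mem_torsion_iff _ _).1 z'.2, fun K hK hKI => ?_⟩
  let f := quotientHom _ hKI
  have hf : f ≫ (injectiveResolution M).cocomplex.d i ((ComplexShape.up ℕ).next i) = 0 := by
    apply quotient_hom_ext
    refine (congrArg ((injectiveResolution M).cocomplex.d i ((ComplexShape.up ℕ).next i)).hom
      (quotientHom_one _ hKI)).trans ?_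
    exact congrArg Subtype.val (show (T.functor.map
      ((injectiveResolution M).cocomplex.d i ((ComplexShape.up ℕ).next i))).hom z.1 = 0 from z.2)
  refine ⟨derivedMk _ (injectiveResolution M) i ⟨f, hf⟩, ?_⟩
  refine rightDerived_app_derivedMk (hT.evalOne hK) (injectiveResolution M) i _ z ?_
  exact Subtype.ext (quotientHom_one _ hKI).symm

/-- If the image cocycle is the boundary of a torsion element `w`, then `w` also becomes a
homomorphism from a cyclic module once `I` is shrunk into its annihilator. -/
lemma exists_map_eq_zero (hT : T.IsDefinedBy F) (i : ℕ) (M : ModuleCat.{u} A) {I : Ideal A} (hI : F I)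
    (y : ((extRight A i).obj (op (ModuleCat.of A (A ⧸ I)))).obj M)
    (hy : ((hT.extRightToDerived hI i).app M).hom y = 0) :
    ∃ J, F J ∧ ∃ h : J ≤ I, (((extRight A i).map (quotientMap h).op).app M).hom y = 0 := by
  obtain ⟨z, rfl⟩ := derivedMk_surjective _ (injectiveResolution M) i y
  have hz : (T.functor.map
      ((injectiveResolution M).cocomplex.d i ((ComplexShape.up ℕ).next i))).hom
      (((hT.evalOne hI).app _).hom z.1) = 0 := by
    refine congr($((hT.evalOne hI).naturality _).hom z.1).symm.trans ?_
    exact (congrArg ((hT.evalOne hI).app _).hom z.2).trans (map_zero _)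
  have h1 := rightDerived_app_derivedMk (hT.evalOne hI) (injectiveResolution M) i z ⟨_, hz⟩ rfl
  have h2 := (derivedMk_eq_zero_iff _ _ _ _).1 (h1.symm.trans hy)
  obtain ⟨w, hw⟩ := h2
  let w' : T.torsion ((injectiveResolution M).cocomplex.X ((ComplexShape.up ℕ).prev i)) := w
  refine ⟨I ⊓ Ideal.torsionOf A _ w'.1, hT.inf hI ((hT.mem_torsion_iff _ _).1 w'.2),
    inf_le_left, ?_⟩
  have hz2 : (quotientMap (I := I ⊓ Ideal.torsionOf A _ w'.1) inf_le_left ≫ injCocycleHom z) ≫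
      (injectiveResolution M).cocomplex.d i ((ComplexShape.up ℕ).next i) = 0 := by
    rw [Category.assoc, injCocycleHom_comp_d, comp_zero]
  have h3 := rightDerived_app_derivedMk ((linearCoyoneda A (ModuleCat.{u} A)).map
    (quotientMap (I := I ⊓ Ideal.torsionOf A _ w'.1) inf_le_left).op)
    (injectiveResolution M) i z ⟨_, hz2⟩ rfl
  refine h3.trans ((derivedMk_eq_zero_iff _ _ _ _).2 ⟨quotientHom w'.1 inf_le_right, ?_⟩)
  refine quotient_hom_ext (f := quotientHom w'.1 inf_le_right ≫
    (injectiveResolution M).cocomplex.d _ i) (g := quotientMap inf_le_left ≫ injCocycleHom z) ?_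
  refine (congrArg ((injectiveResolution M).cocomplex.d _ i).hom
    (quotientHom_one w'.1 inf_le_right)).trans ?_
  exact congrArg Subtype.val hw

/-- If the filter has a least element `I`, then the derived functors are the functors
`Ext^i(A ⧸ I, -)`. -/
lemma isZero_derived_iff (hT : T.IsDefinedBy F) {I : Ideal A} (hI : F I) (hmin : ∀ J, F J → I ≤ J) (i : ℕ)
    (M : ModuleCat.{u} A) :
    IsZero ((T.derived i).obj M) ↔
      Subsingleton (Abelian.Ext (ModuleCat.of A (A ⧸ I)) M i) := by
  have hinj : Function.Injective ((hT.extRightToDerived hI i).app M).hom := by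
    rw [injective_iff_map_eq_zero]
    intro y hy
    obtain ⟨J, hJ, h, h0⟩ := hT.exists_map_eq_zero i M hI y hy
    obtain rfl := le_antisymm h (hmin J hJ)
    have h1 : quotientMap h = 𝟙 _ := quotient_hom_ext rfl
    have h2 : (extRight A i).map (quotientMap h).op = 𝟙 _ := by
      rw [h1, op_id, CategoryTheory.Functor.map_id]
    rwa [h2] at h0
  have hsurj : Function.Surjective ((hT.extRightToDerived hI i).app M).hom := by
    intro x
    obtain ⟨J, hJ, h⟩ := hT.exists_extRightToDerived_eq i M x
    exact h I hI (hmin J hJ)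
  have e := (LinearEquiv.ofBijective _ ⟨hinj, hsurj⟩).symm.trans
    (extRightEquiv (ModuleCat.of A (A ⧸ I)) M i)
  rw [ModuleCat.isZero_iff_subsingleton]
  exact e.toEquiv.subsingleton_congr

end IsDefinedBy

end TorsionTheory

/-! ### Derived torsion functors as colimits of local cohomology functors -/

section EvalColimit

variable {A : Type u} [CommRing A]

lemma exists_colimit_rep {J : Type u} [SmallCategory J] [IsFiltered J]
    (D : J ⥤ ModuleCat.{u} A ⥤ ModuleCat.{u} A) {c : Cocone D} (hc : IsColimit c)
    (M : ModuleCat.{u} A) (x : c.pt.obj M) :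
    ∃ (j : J) (y : (D.obj j).obj M), ((c.ι.app j).app M).hom y = x :=
  Concrete.isColimit_exists_rep _
    (isColimitOfPreserves ((evaluation (ModuleCat.{u} A) (ModuleCat.{u} A)).obj M) hc) x

/-- The powers of one ideal are indexed in universe `0`, the ideals of a filter in universe `u`, so
both versions are needed. -/
lemma exists_colimit_rep' {J : Type} [SmallCategory J] [IsFiltered J]
    (D : J ⥤ ModuleCat.{u} A ⥤ ModuleCat.{u} A) {c : Cocone D} (hc : IsColimit c)
    (M : ModuleCat.{u} A) (x : c.pt.obj M) :
    ∃ (j : J) (y : (D.obj j).obj M), ((c.ι.app j).app M).hom y = x :=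
  have : PreservesFilteredColimitsOfSize.{0, 0} (forget (ModuleCat.{u} A)) :=
    preservesFilteredColimitsOfSize_shrink.{0, u, 0, u} _
  Concrete.isColimit_exists_rep _
    (isColimitOfPreserves ((evaluation (ModuleCat.{u} A) (ModuleCat.{u} A)).obj M) hc) x

end EvalColimit

lemma extBalance_app_app_bijective {A : Type u} [CommRing A] (i : ℕ) (N : (ModuleCat.{u} A)ᵒᵖ)
    (M : ModuleCat.{u} A) : Function.Bijective (((extBalance A i).hom.app N).app M).hom :=
  (((extBalance A i).app N).app M).toLinearEquiv.bijective

/-- The natural map from `Ext^i(A ⧸ I ^ n, -)` to local cohomology. -/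
def extToLocalCohomology {A : Type u} [CommRing A] (I : Ideal A) (n : ℕ) (i : ℕ) :
    (Ext A (ModuleCat.{u} A) i).obj (op (ModuleCat.of A (A ⧸ I ^ n))) ⟶ localCohomology I i :=
  have := localCohomology.hasColimitDiagram.{u, 0} (localCohomology.idealPowersDiagram I) i
  colimit.ι (localCohomology.diagram (localCohomology.idealPowersDiagram I) i) (op (op n))

lemma extToLocalCohomology_w {A : Type u} [CommRing A] (I : Ideal A) {n m : ℕ} (h : n ≤ m)
    (i : ℕ) :
    (Ext A (ModuleCat.{u} A) i).map (TorsionTheory.quotientMap (Ideal.pow_le_pow_right h)).op ≫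
      extToLocalCohomology I m i = extToLocalCohomology I n i :=
  have := localCohomology.hasColimitDiagram.{u, 0} (localCohomology.idealPowersDiagram I) i
  colimit.w (localCohomology.diagram (localCohomology.idealPowersDiagram I) i)
    (homOfLE h).op.op

lemma extToLocalCohomology_map {A : Type u} [CommRing A] {I J : Ideal A} (h : I ≤ J) (n : ℕ)
    (i : ℕ) :
    extToLocalCohomology J n i ≫ localCohomologyMap h i =
    (Ext A (ModuleCat.{u} A) i).map (TorsionTheory.quotientMap (Ideal.pow_right_mono h n)).op ≫
      extToLocalCohomology I n i :=
  have := localCohomology.hasColimitDiagram.{u, 0} (localCohomology.idealPowersDiagram I) i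
  have := localCohomology.hasColimitDiagram.{u, 0} (localCohomology.idealPowersDiagram J) i
  ι_colimMap _ _

lemma localCohomology_hom_ext {A : Type u} [CommRing A] {I : Ideal A} {i : ℕ}
    {G : ModuleCat.{u} A ⥤ ModuleCat.{u} A} {f g : localCohomology I i ⟶ G}
    (h : ∀ n, extToLocalCohomology I n i ≫ f = extToLocalCohomology I n i ≫ g) : f = g :=
  have := localCohomology.hasColimitDiagram.{u, 0} (localCohomology.idealPowersDiagram I) i
  colimit.hom_ext fun n => h n.unop.unop

lemma exists_extToLocalCohomology_eq {A : Type u} [CommRing A] (I : Ideal A) (i : ℕ)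
    (M : ModuleCat.{u} A) (x : (localCohomology I i).obj M) :
    ∃ (n : ℕ) (y : ((Ext A (ModuleCat.{u} A) i).obj (op (ModuleCat.of A (A ⧸ I ^ n)))).obj M),
      ((extToLocalCohomology I n i).app M).hom y = x := by
  have := localCohomology.hasColimitDiagram.{u, 0} (localCohomology.idealPowersDiagram I) i
  obtain ⟨n, y, hy⟩ := exists_colimit_rep'
    (localCohomology.diagram (localCohomology.idealPowersDiagram I) i)
    (colimit.isColimit _) M x
  exact ⟨n.unop.unop, y, hy⟩

namespace TorsionTheory.IsDefinedBy

variable {A : Type u} [CommRing A] {T : TorsionTheory A} {F : Ideal A → Prop}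

/-- The natural map from `Ext^i(A ⧸ I, -)` to the derived functors of the torsion functor. -/
def extToDerived (hT : T.IsDefinedBy F) {I : Ideal A} (hI : F I) (i : ℕ) :
    (Ext A (ModuleCat.{u} A) i).obj (op (ModuleCat.of A (A ⧸ I))) ⟶ T.derived i :=
  (extBalance A i).hom.app _ ≫ hT.extRightToDerived hI i

lemma map_comp_extToDerived (hT : T.IsDefinedBy F) {I J : Ideal A} (h : I ≤ J) (hI : F I)
    (hJ : F J) (i : ℕ) :
    (Ext A (ModuleCat.{u} A) i).map (quotientMap h).op ≫ hT.extToDerived hI i =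
      hT.extToDerived hJ i := by
  rw [extToDerived, NatTrans.naturality_assoc, map_comp_extRightToDerived hT h hI hJ]
  rfl

/-- The natural map from local cohomology to the derived functors of the torsion functor. -/
def localCohomologyToDerived (hT : T.IsDefinedBy F) {I : Ideal A} (hI : F I) (i : ℕ) :
    localCohomology I i ⟶ T.derived i :=
  have := localCohomology.hasColimitDiagram.{u, 0} (localCohomology.idealPowersDiagram I) i
  colimit.desc (localCohomology.diagram (localCohomology.idealPowersDiagram I) i)
    { pt := T.derived i
      ι :=
        { app n := hT.extToDerived (hT.pow hI n.unop.unop) i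
          naturality n m _ :=
            (hT.map_comp_extToDerived _ (hT.pow hI m.unop.unop)
              (hT.pow hI n.unop.unop) i).trans (Category.comp_id _).symm } }

lemma ext_comp_localCohomologyToDerived (hT : T.IsDefinedBy F) {I : Ideal A} (hI : F I)
    (n i : ℕ) : extToLocalCohomology I n i ≫ hT.localCohomologyToDerived hI i =
      hT.extToDerived (hT.pow hI n) i :=
  have := localCohomology.hasColimitDiagram.{u, 0} (localCohomology.idealPowersDiagram I) i
  colimit.ι_desc _ _

lemma map_comp_localCohomologyToDerived (hT : T.IsDefinedBy F) {I J : Ideal A} (h : I ≤ J)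
    (hI : F I) (hJ : F J) (i : ℕ) :
    localCohomologyMap h i ≫ hT.localCohomologyToDerived hI i =
      hT.localCohomologyToDerived hJ i := by
  refine localCohomology_hom_ext fun n => ?_
  rw [← Category.assoc, extToLocalCohomology_map, Category.assoc,
    ext_comp_localCohomologyToDerived, ext_comp_localCohomologyToDerived,
    map_comp_extToDerived]

/-- The natural map from the colimit of the local cohomology functors to the derived functors of
the torsion functor. -/
def colimitToDerived (hT : T.IsDefinedBy F) (i : ℕ) :
    colimit (localCohomologySystem T.gabriel i) ⟶ T.derived i :=
  colimit.desc (localCohomologySystem T.gabriel i)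
    { pt := T.derived i
      ι :=
        { app I := hT.localCohomologyToDerived (I := I.unop.1)
            ((hT.mem_gabriel_iff _).1 I.unop.2) i
          naturality I J f :=
            (hT.map_comp_localCohomologyToDerived f.unop.le ((hT.mem_gabriel_iff _).1 J.unop.2)
              ((hT.mem_gabriel_iff _).1 I.unop.2) i).trans (Category.comp_id _).symm } }

/-- The natural map from a local cohomology functor to the colimit of these functors. -/
def localCohomologyToColimit (T : TorsionTheory A) {I : Ideal A} (hI : I ∈ T.gabriel) (i : ℕ) :
    localCohomology I i ⟶ colimit (localCohomologySystem T.gabriel i) :=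
  colimit.ι (localCohomologySystem T.gabriel i) (op ⟨I, hI⟩)

lemma map_comp_localCohomologyToColimit (T : TorsionTheory A) {I J : Ideal A} (h : I ≤ J)
    (hI : I ∈ T.gabriel) (hJ : J ∈ T.gabriel) (i : ℕ) :
    localCohomologyMap h i ≫ localCohomologyToColimit T hI i = localCohomologyToColimit T hJ i :=
  colimit.w (localCohomologySystem T.gabriel i)
    (homOfLE h : (⟨I, hI⟩ : T.gabriel) ⟶ ⟨J, hJ⟩).op

lemma localCohomologyToColimit_comp (hT : T.IsDefinedBy F) {I : Ideal A} (hI : I ∈ T.gabriel)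
    (i : ℕ) : localCohomologyToColimit T hI i ≫ hT.colimitToDerived i =
      hT.localCohomologyToDerived ((hT.mem_gabriel_iff I).1 hI) i :=
  colimit.ι_desc (F := localCohomologySystem T.gabriel i) _ (op ⟨I, hI⟩)

/-- The natural map from `Ext^i(A ⧸ I ^ n, -)` to the colimit of the local cohomology functors. -/
def extToColimit (T : TorsionTheory A) {I : Ideal A} (hI : I ∈ T.gabriel) (n i : ℕ) :
    (Ext A (ModuleCat.{u} A) i).obj (op (ModuleCat.of A (A ⧸ I ^ n))) ⟶
      colimit (localCohomologySystem T.gabriel i) :=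
  extToLocalCohomology I n i ≫ localCohomologyToColimit T hI i

lemma extToColimit_w (T : TorsionTheory A) {I : Ideal A} (hI : I ∈ T.gabriel) {n m : ℕ}
    (h : n ≤ m) (i : ℕ) :
    (Ext A (ModuleCat.{u} A) i).map (quotientMap (Ideal.pow_le_pow_right h)).op ≫
      extToColimit T hI m i = extToColimit T hI n i := by
  rw [extToColimit, ← Category.assoc, extToLocalCohomology_w I h, extToColimit]

lemma extToColimit_map (T : TorsionTheory A) {I J : Ideal A} (h : I ≤ J) (hI : I ∈ T.gabriel)
    (hJ : J ∈ T.gabriel) (n i : ℕ) :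
    (Ext A (ModuleCat.{u} A) i).map (quotientMap (Ideal.pow_right_mono h n)).op ≫
      extToColimit T hI n i = extToColimit T hJ n i := by
  rw [extToColimit, ← Category.assoc, ← extToLocalCohomology_map h, Category.assoc,
    map_comp_localCohomologyToColimit T h hI hJ, extToColimit]

lemma extToColimit_comp (hT : T.IsDefinedBy F) {I : Ideal A} (hI : I ∈ T.gabriel) (n i : ℕ) :
    extToColimit T hI n i ≫ hT.colimitToDerived i =
      hT.extToDerived (hT.pow ((hT.mem_gabriel_iff I).1 hI) n) i := by
  rw [extToColimit, Category.assoc, hT.localCohomologyToColimit_comp,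
    hT.ext_comp_localCohomologyToDerived]

lemma exists_extToColimit_eq (hT : T.IsDefinedBy F) (i : ℕ) (M : ModuleCat.{u} A)
    (x : (colimit (localCohomologySystem T.gabriel i)).obj M) :
    ∃ (I : Ideal A) (hI : I ∈ T.gabriel) (n : ℕ)
      (y : ((Ext A (ModuleCat.{u} A) i).obj (op (ModuleCat.of A (A ⧸ I ^ n)))).obj M),
      ((extToColimit T hI n i).app M).hom y = x := by
  have : Nonempty T.gabriel := ⟨⟨⊤, (hT.mem_gabriel_iff _).2 hT.top⟩⟩
  have : IsCodirectedOrder T.gabriel := ⟨fun I J =>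
    ⟨⟨I ⊓ J, (hT.mem_gabriel_iff _).2 (hT.inf ((hT.mem_gabriel_iff _).1 I.2)
      ((hT.mem_gabriel_iff _).1 J.2))⟩,
      (inf_le_left : I.1 ⊓ J.1 ≤ I.1), (inf_le_right : I.1 ⊓ J.1 ≤ J.1)⟩⟩
  obtain ⟨I, y, rfl⟩ := exists_colimit_rep _
    (colimit.isColimit (localCohomologySystem T.gabriel i)) M x
  obtain ⟨n, z, rfl⟩ := exists_extToLocalCohomology_eq I.unop.1 i M y
  exact ⟨I.unop.1, I.unop.2, n, z, rfl⟩

lemma colimitToDerived_app_injective (hT : T.IsDefinedBy F) (i : ℕ) (M : ModuleCat.{u} A) :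
    Function.Injective ((hT.colimitToDerived i).app M).hom := by
  rw [injective_iff_map_eq_zero]
  intro x hx
  obtain ⟨I, hI, n, y, rfl⟩ := hT.exists_extToColimit_eq i M x
  have hF := (hT.mem_gabriel_iff I).1 hI
  have h1 : ((hT.extToDerived (hT.pow hF n) i).app M).hom y = 0 := by
    rw [← hT.extToColimit_comp hI n i]
    exact hx
  obtain ⟨J, hJ, hJI, h2⟩ := hT.exists_map_eq_zero i M (hT.pow hF n)
    ((((extBalance A i).hom.app _).app M).hom y) h1
  have h3 : (((Ext A (ModuleCat.{u} A) i).map (quotientMap hJI).op).app M).hom y = 0 := by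
    apply (extBalance_app_app_bijective i (op (ModuleCat.of A (A ⧸ J))) M).1
    rw [map_zero]
    exact congr(($((extBalance A i).hom.naturality (quotientMap hJI).op).app M).hom y).trans h2
  -- The class dies over `A ⧸ J`, but the colimit involves only powers, so a power inside `J` is
  -- needed. The exponent is `n + 1` because `n` may be `0`.
  let K := J ⊓ I
  have hK : K ∈ T.gabriel := (hT.mem_gabriel_iff _).2 (hT.inf hJ hF)
  have hKJ : K ^ (n + 1) ≤ J := (Ideal.pow_le_self n.succ_ne_zero).trans inf_le_left
  -- Both sides come from the projection `A ⧸ K ^ (n + 1) → A ⧸ I ^ n`, factored through `J` or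
  -- through `I ^ (n + 1)`.
  have h5 : (Ext A (ModuleCat.{u} A) i).map (quotientMap hJI).op ≫
      (Ext A (ModuleCat.{u} A) i).map (quotientMap hKJ).op ≫ extToColimit T hK (n + 1) i =
      extToColimit T hI n i := by
    rw [← extToColimit_w T hI n.le_succ, ← extToColimit_map T (inf_le_right : K ≤ I) hK hI,
      ← Functor.map_comp_assoc, ← Functor.map_comp_assoc, ← op_comp, ← op_comp]
    congr 3
    exact quotient_hom_ext rfl
  rw [← h5]
  refine (congrArg ((((Ext A (ModuleCat.{u} A) i).map (quotientMap hKJ).op ≫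
    extToColimit T hK (n + 1) i).app M).hom) h3).trans (map_zero _)

lemma colimitToDerived_app_surjective (hT : T.IsDefinedBy F) (i : ℕ) (M : ModuleCat.{u} A) :
    Function.Surjective ((hT.colimitToDerived i).app M).hom := by
  intro x
  obtain ⟨I, hI, h⟩ := hT.exists_extRightToDerived_eq i M x
  obtain ⟨y, hy⟩ := h (I ^ 1) (hT.pow hI 1) (Ideal.pow_le_self one_ne_zero)
  obtain ⟨z, rfl⟩ := (extBalance_app_app_bijective i (op (ModuleCat.of A (A ⧸ I ^ 1))) M).2 y
  refine ⟨((extToColimit T ((hT.mem_gabriel_iff I).2 hI) 1 i).app M).hom z, ?_⟩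
  rw [← hy]
  exact congr(($(hT.extToColimit_comp ((hT.mem_gabriel_iff I).2 hI) 1 i).app M).hom z)

/-- The derived functors of a torsion functor are the colimits of the local cohomology functors
with supports in the ideals of the Gabriel filtration. -/
theorem derived_iso_colimit_localCohomology (hT : T.IsDefinedBy F) (i : ℕ) :
    Nonempty (T.derived i ≅ colimit (localCohomologySystem T.gabriel i)) := by
  have : ∀ M, IsIso ((hT.colimitToDerived i).app M) := fun M => by
    have := (ModuleCat.mono_iff_injective _).2 (hT.colimitToDerived_app_injective i M)
    have := (ModuleCat.epi_iff_surjective _).2 (hT.colimitToDerived_app_surjective i M)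
    exact isIso_of_mono_of_epi _
  have := NatIso.isIso_of_isIso_app (hT.colimitToDerived i)
  exact ⟨(asIso (hT.colimitToDerived i)).symm⟩

/-- A nonzero class in a derived functor comes from the local cohomology of a single ideal, which is
then nonzero in the same degree. -/
theorem cd_le_sSup_localCohomology (hT : T.IsDefinedBy F) :
    T.cd ≤ sSup {d : WithBot ℕ∞ | ∃ I ∈ T.gabriel,
      d = cohomologicalDimension (localCohomology I)} := by
  refine sSup_le ?_
  rintro d ⟨i, rfl, M, hM⟩
  rw [ModuleCat.isZero_iff_subsingleton, not_subsingleton_iff_nontrivial] at hM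
  obtain ⟨x, hx⟩ := exists_ne (0 : (T.derived i).obj M)
  obtain ⟨y, rfl⟩ := hT.colimitToDerived_app_surjective i M x
  obtain ⟨I, hI, n, z, rfl⟩ := hT.exists_extToColimit_eq i M y
  refine le_trans ?_ (le_sSup ⟨I, hI, rfl⟩)
  refine le_sSup ⟨i, rfl, M, fun h => hx ?_⟩
  rw [ModuleCat.isZero_iff_subsingleton] at h
  have h1 : ((extToLocalCohomology I n i).app M).hom z = 0 := Subsingleton.elim _ _
  have h2 : ((extToColimit T hI n i).app M).hom z = 0 :=
    (congrArg ((localCohomologyToColimit T hI i).app M).hom h1).trans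
      (map_zero _)
  rw [h2, map_zero]

end TorsionTheory.IsDefinedBy

/-! ### Projective dimension of telescopes and of iterated quotients -/

section ProjectiveDimension

variable {A : Type u} [CommRing A]

/-- Dimension shifting along a direct sum of free presentations. The bound is strict: `0` means zero
and `1` means projective. These are treated apart because passing to the syzygy only relates `n + 2`
to `n + 1`. -/
lemma ModuleCat.hasProjectiveDimensionLT_finsupp (n : ℕ) (M : Type u) [AddCommGroup M] [Module A M]
    (hM : HasProjectiveDimensionLT (ModuleCat.of A M) n) :
    HasProjectiveDimensionLT (ModuleCat.of A (ℕ →₀ M)) n := by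
  induction n using Nat.strong_induction_on generalizing M with
  | _ n ih =>
  match n, hM, ih with
  | 0, hM, _ =>
    rw [hasProjectiveDimensionLT_zero_iff_isZero] at hM ⊢
    have := ModuleCat.subsingleton_of_isZero hM
    have : Subsingleton M := this
    exact ModuleCat.isZero_of_subsingleton (ModuleCat.of A (ℕ →₀ M))
  | 1, hM, _ =>
    rw [← projective_iff_hasProjectiveDimensionLT_one, ← IsProjective.iff_projective] at hM ⊢
    classical exact .of_equiv (finsuppLequivDFinsupp A).symm
  | n + 2, hM, ih =>
    let π : (M →₀ A) →ₗ[A] M := Finsupp.linearCombination A id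
    have hπ : Function.Surjective π := Finsupp.linearCombination_id_surjective A M
    have hP : Projective (ModuleCat.of A (M →₀ A)) :=
      (IsProjective.iff_projective _).1 inferInstance
    have hP' : Projective (ModuleCat.of A (ℕ →₀ M →₀ A)) :=
      (IsProjective.iff_projective _).1 inferInstance
    have hK := ((LinearMap.shortExact_shortComplexKer hπ).hasProjectiveDimensionLT_X₃_iff n hP).1 hM
    have hK' := ih (n + 1) (by omega) (LinearMap.ker π) hK
    let f : (ℕ →₀ LinearMap.ker π) →ₗ[A] (ℕ →₀ M →₀ A) :=
      Finsupp.mapRange.linearMap (LinearMap.ker π).subtype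
    let g : (ℕ →₀ M →₀ A) →ₗ[A] (ℕ →₀ M) := Finsupp.mapRange.linearMap π
    have hfg : Function.Exact f g := by
      rw [LinearMap.exact_iff, Finsupp.ker_mapRange,
        Finsupp.range_mapRange_linearMap _ (Submodule.ker_subtype _), Submodule.range_subtype]
    have hf : Function.Injective f :=
      Finsupp.mapRange_injective _ (map_zero _) (Submodule.injective_subtype _)
    have hg : Function.Surjective g := Finsupp.mapRange_surjective _ (map_zero _) hπ
    exact ((ModuleCat.shortComplex_shortExact
      (ModuleCat.shortComplexOfCompEqZero f g hfg.linearMap_comp_eq_zero) hfg hf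
      hg).hasProjectiveDimensionLT_X₃_iff n hP').2 hK'

section Telescope

variable {N Q : Type u} [AddCommGroup N] [Module A N] [AddCommGroup Q] [Module A Q]

/-- The map `⊕ N → ⊕ N` whose cokernel is the direct limit of `N → N → ⋯`, where the `n`-th
transition map is multiplication by `c n`. -/
def telescopeMap (N : Type u) [AddCommGroup N] [Module A N] (c : ℕ → A) :
    (ℕ →₀ N) →ₗ[A] (ℕ →₀ N) :=
  Finsupp.lsum A fun n => Finsupp.lsingle n - c n • Finsupp.lsingle (n + 1)

lemma telescopeMap_single (c : ℕ → A) (n : ℕ) (y : N) :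
    telescopeMap N c (Finsupp.single n y) =
      Finsupp.single n y - Finsupp.single (n + 1) (c n • y) := by
  simp [telescopeMap]

lemma telescopeMap_apply_zero (c : ℕ → A) (f : ℕ →₀ N) : telescopeMap N c f 0 = f 0 := by
  induction f using Finsupp.induction_linear with
  | zero => simp
  | add f g hf hg => simp [hf, hg]
  | single n y => simp [telescopeMap_single]

lemma telescopeMap_apply_succ (c : ℕ → A) (f : ℕ →₀ N) (n : ℕ) :
    telescopeMap N c f (n + 1) = f (n + 1) - c n • f n := by
  induction f using Finsupp.induction_linear with
  | zero => simp
  | add f g hf hg => simp only [map_add, Finsupp.add_apply, hf, hg, smul_add]; abel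
  | single k y =>
    rw [telescopeMap_single]
    rcases eq_or_ne k n with rfl | h
    · simp
    · simp [Finsupp.single_apply, h]

lemma telescopeMap_injective (c : ℕ → A) : Function.Injective (telescopeMap N c) := by
  rw [injective_iff_map_eq_zero]
  intro f hf
  ext n
  induction n with
  | zero => rw [← telescopeMap_apply_zero c f, hf]
  | succ n ih =>
    have h := telescopeMap_apply_succ c f n
    rw [hf, ih] at h
    simpa using h.symm

/-- Modulo the range, an entry `y` at `n` may be moved to `c n • y` at `n + 1`, so everything can be
pushed into one late coordinate. Allowing all large `k` lets two summands meet in the same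
coordinate. -/
lemma exists_sub_single_mem_range_telescopeMap (c : ℕ → A) (f : ℕ →₀ N) :
    ∃ K, ∀ k, K ≤ k → ∃ y, f - Finsupp.single k y ∈ LinearMap.range (telescopeMap N c) := by
  induction f using Finsupp.induction_linear with
  | zero => exact ⟨0, fun k _ => ⟨0, by simp⟩⟩
  | add f g hf hg =>
    obtain ⟨K, hK⟩ := hf
    obtain ⟨L, hL⟩ := hg
    refine ⟨max K L, fun k hk => ?_⟩
    obtain ⟨y, hy⟩ := hK k (le_of_max_le_left hk)
    obtain ⟨z, hz⟩ := hL k (le_of_max_le_right hk)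
    refine ⟨y + z, ?_⟩
    rw [Finsupp.single_add, add_sub_add_comm]
    exact add_mem hy hz
  | single n y =>
    refine ⟨n, fun k hk => ?_⟩
    induction k, hk using Nat.le_induction with
    | base => exact ⟨y, by simp⟩
    | succ k _ ih =>
      obtain ⟨z, hz⟩ := ih
      refine ⟨c k • z, ?_⟩
      rw [← sub_add_sub_cancel _ (Finsupp.single k z)]
      exact add_mem hz ⟨_, telescopeMap_single c k z⟩

/-- A direct limit of a sequence `N → N → ⋯` of multiplication maps has projective dimension at
most one more than that of `N`. -/
lemma ModuleCat.hasProjectiveDimensionLT_of_telescope (φ : ℕ → N →ₗ[A] Q) (c : ℕ → A)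
    (hφ : ∀ n y, φ n y = φ (n + 1) (c n • y)) (hker : ∀ n y, φ n y = 0 → c n • y = 0)
    (hsurj : ∀ q, ∃ n y, φ n y = q) (n : ℕ)
    (hN : HasProjectiveDimensionLT (ModuleCat.of A N) n) :
    HasProjectiveDimensionLT (ModuleCat.of A Q) (n + 1) := by
  let g : (ℕ →₀ N) →ₗ[A] Q := Finsupp.lsum A φ
  have hgs : ∀ n y, g (Finsupp.single n y) = φ n y := fun n y => by simp [g]
  have hcomp : g ∘ₗ telescopeMap N c = 0 := by
    ext n y
    simp [telescopeMap_single, hgs, ← hφ]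
  have hexact : Function.Exact (telescopeMap N c) g := by
    intro f
    refine ⟨fun hf => ?_, ?_⟩
    · obtain ⟨k, hk⟩ := exists_sub_single_mem_range_telescopeMap c f
      obtain ⟨y, z, hz⟩ := hk k le_rfl
      have h0 : φ k y = 0 := by
        have := LinearMap.congr_fun hcomp z
        rw [LinearMap.comp_apply, hz, map_sub, hf, hgs] at this
        simpa using this
      -- Since `c k` kills `y`, the element `single k y` is its own image under the telescope map.
      refine ⟨z + Finsupp.single k y, ?_⟩
      rw [map_add, hz, telescopeMap_single, hker k y h0]
      simp
    · rintro ⟨z, rfl⟩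
      exact LinearMap.congr_fun hcomp z
  have hg : Function.Surjective g := fun q => by
    obtain ⟨n, y, rfl⟩ := hsurj q
    exact ⟨_, hgs n y⟩
  have hN' := ModuleCat.hasProjectiveDimensionLT_finsupp n N hN
  exact (ModuleCat.shortComplex_shortExact
    (ModuleCat.shortComplexOfCompEqZero (telescopeMap N c) g hcomp) hexact
    (telescopeMap_injective c) hg).hasProjectiveDimensionLT_X₃ n hN'
    (hasProjectiveDimensionLT_of_ge _ n (n + 1) n.le_succ)

end Telescope

/-- The principal ideals of the `x n` form an ascending chain, so they generate their union. -/
lemma Ideal.exists_eq_mul_of_mem_span_range {x : ℕ → A} (hx : ∀ n, x (n + 1) ∣ x n) {a : A}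
    (ha : a ∈ Ideal.span (Set.range x)) : ∃ n r, a = r * x n := by
  have hx' : ∀ m n, m ≤ n → x n ∣ x m := fun m n h => by
    induction n, h using Nat.le_induction with
    | base => exact dvd_rfl
    | succ n _ ih => exact (hx n).trans ih
  induction ha using Submodule.span_induction with
  | mem a ha =>
    obtain ⟨n, rfl⟩ := ha
    exact ⟨n, 1, (one_mul _).symm⟩
  | zero => exact ⟨0, 0, (zero_mul _).symm⟩
  | add a b _ _ ha hb =>
    obtain ⟨m, r, rfl⟩ := ha
    obtain ⟨n, s, rfl⟩ := hb
    obtain ⟨r', hr⟩ := hx' m (max m n) (le_max_left _ _)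
    obtain ⟨s', hs⟩ := hx' n (max m n) (le_max_right _ _)
    exact ⟨max m n, r * r' + s * s', by rw [hr, hs]; ring⟩
  | smul a b _ hb =>
    obtain ⟨n, r, rfl⟩ := hb
    exact ⟨n, a * r, by rw [smul_eq_mul, mul_assoc]⟩

/-- Dividing out all the roots `x ^ (1 / q ^ n)` of an element raises the projective dimension of
a quotient ring by at most two, if it has no elements that are nilpotent of order `q`. -/
lemma Ideal.hasProjectiveDimensionLT_quotient_sup_span_range (J : Ideal A) {q : ℕ} (hq : 2 ≤ q)
    (hJ : ∀ a, a ^ q ∈ J → a ∈ J) (x : ℕ → A) (hx : ∀ n, x (n + 1) ^ q = x n) (n : ℕ)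
    (h : HasProjectiveDimensionLT (ModuleCat.of A (A ⧸ J)) n) :
    HasProjectiveDimensionLT (ModuleCat.of A (A ⧸ (J ⊔ Ideal.span (Set.range x)))) (n + 2) := by
  set I := J ⊔ Ideal.span (Set.range x)
  have hdvd : ∀ n, x (n + 1) ∣ x n := fun n => hx n ▸ dvd_pow_self _ (by omega)
  have hxI : ∀ n, x n ∈ I := fun n => Ideal.mem_sup_right (Ideal.subset_span ⟨n, rfl⟩)
  let π : (A ⧸ J) →ₗ[A] (A ⧸ I) := Submodule.mapQ J I LinearMap.id le_sup_left
  have hπ : Function.Surjective π := fun y => by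
    obtain ⟨a, rfl⟩ := Submodule.Quotient.mk_surjective _ y
    exact ⟨Submodule.Quotient.mk a, rfl⟩
  have hmem : ∀ n y, x n • y ∈ LinearMap.ker π := fun n y => by
    obtain ⟨a, rfl⟩ := Submodule.Quotient.mk_surjective _ y
    exact (Submodule.Quotient.mk_eq_zero _).2 (I.mul_mem_right a (hxI n))
  let φ : ℕ → (A ⧸ J) →ₗ[A] LinearMap.ker π := fun n =>
    LinearMap.codRestrict _ (LinearMap.lsmul A _ (x n)) (hmem n)
  -- The kernel is the union of the submodules `x n • (A ⧸ J)`. As `x n = x (n + 1) * x (n + 1) ^ (q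
  -- - 1)`, it is a telescope with these powers as transition maps.
  have hK : HasProjectiveDimensionLT (ModuleCat.of A (LinearMap.ker π)) (n + 1) := by
    refine ModuleCat.hasProjectiveDimensionLT_of_telescope φ (fun n => x (n + 1) ^ (q - 1))
      (fun n y => Subtype.ext ?_) (fun n y hy => ?_) ?_ n h
    · change x n • y = x (n + 1) • x (n + 1) ^ (q - 1) • y
      rw [smul_smul, ← pow_succ', Nat.sub_add_cancel (by omega), hx]
    · have hy' : x n • y = 0 := congrArg Subtype.val hy
      obtain ⟨a, rfl⟩ := Submodule.Quotient.mk_surjective _ y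
      rw [← Submodule.Quotient.mk_smul, Submodule.Quotient.mk_eq_zero, smul_eq_mul] at hy' ⊢
      -- The `q`-th power of `x (n + 1) ^ (q - 1) * a` is a multiple of `x n * a`, which lies in
      -- `J`.
      refine hJ _ ?_
      obtain ⟨k, rfl⟩ := Nat.exists_eq_add_of_le hq
      have : (x (n + 1) ^ (2 + k - 1) * a) ^ (2 + k) =
          x n * a * (x (n + 1) ^ (k * (2 + k)) * a ^ (1 + k)) := by
        rw [← hx n]
        have h1 : 2 + k - 1 = k + 1 := by omega
        rw [h1]
        ring
      rw [this]
      exact J.mul_mem_right _ hy'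
    · rintro ⟨y, hy⟩
      obtain ⟨a, rfl⟩ := Submodule.Quotient.mk_surjective _ y
      have ha : a ∈ I := (Submodule.Quotient.mk_eq_zero _).1 hy
      obtain ⟨j, hj, b, hb, rfl⟩ := Submodule.mem_sup.1 ha
      obtain ⟨n, r, rfl⟩ := Ideal.exists_eq_mul_of_mem_span_range hdvd hb
      refine ⟨n, Submodule.Quotient.mk r, Subtype.ext ?_⟩
      change x n • (Submodule.Quotient.mk r : A ⧸ J) = Submodule.Quotient.mk (j + r * x n)
      rw [← Submodule.Quotient.mk_smul, eq_comm, Submodule.Quotient.eq, smul_eq_mul, mul_comm]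
      simpa using hj
  exact (LinearMap.shortExact_shortComplexKer hπ).hasProjectiveDimensionLT_X₃ (n + 1) hK
    (hasProjectiveDimensionLT_of_ge _ n (n + 1 + 1) (by omega))

end ProjectiveDimension

/-! ### The torsion theory of the roots of an element -/

namespace TorsionTheory.IsDefinedBy

variable {A : Type u} [CommRing A] {T : TorsionTheory A} {F : Ideal A → Prop}

lemma cd_le_of_hasProjectiveDimensionLT (hT : T.IsDefinedBy F) {I : Ideal A} (hI : F I)
    (hmin : ∀ J, F J → I ≤ J) (d : ℕ)
    (h : HasProjectiveDimensionLT (ModuleCat.of A (A ⧸ I)) (d + 1)) :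
    T.cd ≤ ((d : ℕ∞) : WithBot ℕ∞) := by
  refine sSup_le ?_
  rintro _ ⟨i, rfl, M, hM⟩
  rw [hT.isZero_derived_iff hI hmin] at hM
  by_contra! hlt
  have hlt' : d < i := by exact_mod_cast hlt
  exact hM (HasProjectiveDimensionLT.subsingleton _ (d + 1) i hlt' M)

/-- Vanishing of `Ext^d(A ⧸ I, -)` in the single degree `d` already bounds the projective dimension
below `d`, so a failure of the bound shows up in degree `d` itself. -/
lemma le_cd_of_not_hasProjectiveDimensionLT (hT : T.IsDefinedBy F) {I : Ideal A} (hI : F I)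
    (hmin : ∀ J, F J → I ≤ J) (d : ℕ)
    (h : ¬ HasProjectiveDimensionLT (ModuleCat.of A (A ⧸ I)) d) :
    ((d : ℕ∞) : WithBot ℕ∞) ≤ T.cd := by
  by_contra hlt
  refine h (hasProjectiveDimensionLT_of_enoughInjectives _ d fun M => ?_)
  rw [← hT.isZero_derived_iff hI hmin]
  by_contra hM
  exact hlt (le_sSup ⟨d, rfl, M, hM⟩)

end TorsionTheory.IsDefinedBy

/-- Let `s` split the canonical map from the free module on `I`, and fix `b ≠ 0` in `I`. From `b • s
a = a • s b` the support of `s a` lies in the finite support of `s b`, whose elements therefore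
generate `I`. -/
lemma Ideal.fg_of_projective {A : Type*} [CommRing A] [IsDomain A] (I : Ideal A)
    [Module.Projective A I] : I.FG := by
  classical
  rcases eq_or_ne I ⊥ with rfl | hI
  · exact Submodule.fg_bot
  obtain ⟨b, hb, hb0⟩ := Submodule.exists_mem_ne_zero_of_ne_bot hI
  obtain ⟨s, hs⟩ := (Module.projective_def (R := A) (P := I)).1 inferInstance
  refine ⟨(s ⟨b, hb⟩).support.image Subtype.val, le_antisymm ?_ fun a ha => ?_⟩
  · rw [Submodule.span_le]
    intro a ha
    obtain ⟨c, _, rfl⟩ := Finset.mem_image.1 ha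
    exact c.2
  · have hsupp : (s ⟨a, ha⟩).support ⊆ (s ⟨b, hb⟩).support := fun i hi => by
      have h1 : b • s ⟨a, ha⟩ = a • s ⟨b, hb⟩ := by
        rw [← map_smul, ← map_smul]
        exact congrArg s (Subtype.ext (mul_comm b a))
      have h2 := DFunLike.congr_fun h1 i
      rw [Finsupp.mem_support_iff] at hi ⊢
      intro h0
      simp only [Finsupp.smul_apply, h0, mul_zero, smul_eq_mul, mul_eq_zero] at h2
      exact h2.elim hb0 hi
    have h3 := congrArg Subtype.val (hs ⟨a, ha⟩)
    rw [Finsupp.linearCombination_apply, Finsupp.sum, AddSubmonoidClass.coe_finsetSum] at h3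
    change _ = a at h3
    rw [← h3]
    refine Submodule.sum_mem _ fun i hi => Submodule.smul_mem _ _ (Submodule.subset_span ?_)
    exact Finset.mem_coe.2 (Finset.mem_image_of_mem _ (hsupp hi))

/-- Otherwise `I` would be projective, hence finitely generated, and a finitely generated idempotent
ideal of a domain is zero or the whole ring. -/
lemma Ideal.not_hasProjectiveDimensionLT_two_quotient {A : Type u} [CommRing A] [IsDomain A]
    {I : Ideal A} (hI : IsIdempotentElem I) (hbot : I ≠ ⊥) (htop : I ≠ ⊤) :
    ¬ HasProjectiveDimensionLT (ModuleCat.of A (A ⧸ I)) 2 := by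
  intro h
  have hP : Projective (ModuleCat.of A A) := (IsProjective.iff_projective _).1 inferInstance
  have hK := ((LinearMap.shortExact_shortComplexKer
    (Submodule.mkQ_surjective I)).hasProjectiveDimensionLT_X₃_iff 0 hP).1 h
  rw [← projective_iff_hasProjectiveDimensionLT_one, ← IsProjective.iff_projective] at hK
  have : Module.Projective A I :=
    .of_equiv (LinearEquiv.ofEq _ _ (Submodule.ker_mkQ I))
  rcases (Ideal.isIdempotentElem_iff_eq_bot_or_top I I.fg_of_projective).1 hI with h | h
  exacts [hbot h, htop h]

lemma Ideal.hasProjectiveDimensionLT_one_quotient_bot (A : Type u) [CommRing A] :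
    HasProjectiveDimensionLT (ModuleCat.of A (A ⧸ (⊥ : Ideal A))) 1 := by
  have hP : Projective (ModuleCat.of A (A ⧸ (⊥ : Ideal A))) :=
    (IsProjective.iff_projective _).1
      (.of_equiv (Submodule.quotEquivOfEqBot (⊥ : Ideal A) rfl).symm)
  infer_instance

lemma Ideal.isIdempotentElem_span_range {A : Type*} [CommRing A] {q : ℕ} (hq : 2 ≤ q)
    {x : ℕ → A} (hx : ∀ n, x (n + 1) ^ q = x n) :
    IsIdempotentElem (Ideal.span (Set.range x)) := by
  refine le_antisymm Ideal.mul_le_left (Ideal.span_le.2 ?_)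
  rintro _ ⟨n, rfl⟩
  have h : x (n + 1) ∈ Ideal.span (Set.range x) := Ideal.subset_span ⟨n + 1, rfl⟩
  obtain ⟨k, rfl⟩ := Nat.exists_eq_add_of_le hq
  rw [SetLike.mem_coe, ← hx n, pow_add, pow_two]
  exact Ideal.mul_mem_right _ _ (Ideal.mul_mem_mul h h)

lemma exists_iterated_root_sequence {B : Type*} [CommRing B] {q : ℕ} (hroot : ∀ a : B, ∃ b, b ^ q = a) (a : B) :
    ∃ x : ℕ → B, x 0 = a ∧ ∀ n, x (n + 1) ^ q = x n := by
  choose r hr using hroot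
  exact ⟨fun n => r^[n] a, rfl, fun n => by simp only [Function.iterate_succ_apply', hr]⟩

lemma iterated_root_sequence_pow {B : Type*} [CommRing B] {q : ℕ} {x : ℕ → B} (hx : ∀ n, x (n + 1) ^ q = x n) (n : ℕ) :
    x n ^ q ^ n = x 0 := by
  induction n with
  | zero => simp
  | succ n ih => rw [pow_succ', pow_mul, hx, ih]

lemma torsionTheoryOfElement_isDefinedBy {R : Type u} [CommRing R] [IsDomain R]
    (x : AbsoluteIntegralClosure R) :
    (torsionTheoryOfElement x).IsDefinedBy fun I =>
      ∀ (n : ℕ) (y : AbsoluteIntegralClosure R), 0 < n → y ^ n = x → y ∈ I :=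
  TorsionTheory.ofFilter_isDefinedBy ..

open AbsoluteIntegralClosure in
theorem torsionTheoryOfElement_cd {R : Type u} [CommRing R] [IsDomain R]
    [IsLocalRing (AbsoluteIntegralClosure R)] {x : AbsoluteIntegralClosure R}
    (hx : x ∈ IsLocalRing.maximalIdeal (AbsoluteIntegralClosure R)) (hx0 : x ≠ 0) :
    (torsionTheoryOfElement x).cd = 2 := by
  obtain ⟨y, hy0, hy⟩ := exists_iterated_root_sequence (fun a => exists_root a two_pos) x
  set I := Ideal.span (Set.range y) with hIdef
  have hT := torsionTheoryOfElement_isDefinedBy x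
  have hI : ∀ (n : ℕ) (z : AbsoluteIntegralClosure R), 0 < n → z ^ n = x → z ∈ I :=
    fun n z hn hz => by
      -- Iterated square roots suffice: since `n ≤ 2 ^ n`, the `2 ^ n`-th root `y n` divides every
      -- `n`-th root of `x`.
      have h := root_dvd_root hn n.lt_two_pow_self.le
        ((iterated_root_sequence_pow hy n).trans (hy0.trans hz.symm))
      exact Ideal.mem_of_dvd _ h (Ideal.subset_span ⟨n, rfl⟩)
  have hmin : ∀ J : Ideal (AbsoluteIntegralClosure R),
      (∀ (n : ℕ) (z : AbsoluteIntegralClosure R), 0 < n → z ^ n = x → z ∈ J) → I ≤ J := by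
    intro J hJ
    rw [hIdef, Ideal.span_le]
    rintro _ ⟨n, rfl⟩
    exact hJ (2 ^ n) _ (by positivity) ((iterated_root_sequence_pow hy n).trans hy0)
  refine le_antisymm ?_ ?_
  · refine hT.cd_le_of_hasProjectiveDimensionLT hI hmin 2 ?_
    have h := Ideal.hasProjectiveDimensionLT_quotient_sup_span_range ⊥ le_rfl
      (fun a ha => eq_zero_of_pow_eq_zero ha) y hy 1
      (Ideal.hasProjectiveDimensionLT_one_quotient_bot _)
    rwa [bot_sup_eq] at h
  · refine hT.le_cd_of_not_hasProjectiveDimensionLT hI hmin 2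
      (Ideal.not_hasProjectiveDimensionLT_two_quotient (Ideal.isIdempotentElem_span_range le_rfl hy)
        ?_ ?_)
    · intro h
      exact hx0 (by simpa [h] using hI 1 x one_pos (pow_one x))
    · refine ((hmin _ fun n z hn hz => ?_).trans_lt
        (lt_top_iff_ne_top.2 (IsLocalRing.maximalIdeal.isMaximal _).ne_top)).ne
      exact Ideal.IsPrime.mem_of_pow_mem inferInstance n (hz ▸ hx)

/-! ### Modules killed by the maximal ideal -/

section RootClosed

variable {B : Type u} [CommRing B] {p : ℕ}

/-- Adjoining all `p`-power roots of an element to an ideal that contains the prime `p` preserves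
the property that the ideal is closed under `p`-th roots. -/
lemma Ideal.mem_sup_span_range_of_pow_mem (hp : p.Prime) (hroot : ∀ a : B, ∃ b, b ^ p = a)
    {J : Ideal B} (hpJ : (p : B) ∈ J) (hJ : ∀ a, a ^ p ∈ J → a ∈ J) {x : ℕ → B}
    (hx : ∀ n, x (n + 1) ^ p = x n) {a : B} (ha : a ^ p ∈ J ⊔ Ideal.span (Set.range x)) :
    a ∈ J ⊔ Ideal.span (Set.range x) := by
  obtain ⟨j, hj, b, hb, hab⟩ := Submodule.mem_sup.1 ha
  obtain ⟨n, r, rfl⟩ := Ideal.exists_eq_mul_of_mem_span_range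
    (fun n => hx n ▸ dvd_pow_self _ hp.ne_zero) hb
  -- Now `a ^ p` is congruent modulo `J` to the `p`-th power of `s * x (n + 1)`. As `p ∈ J`,
  -- Frobenius is additive modulo `J`, so the difference `a - s * x (n + 1)` has its `p`-th power in
  -- `J`.
  obtain ⟨s, rfl⟩ := hroot r
  obtain ⟨t, ht⟩ := exists_add_pow_prime_eq hp (a - s * x (n + 1)) (s * x (n + 1))
  rw [sub_add_cancel, ← hab, mul_pow, hx] at ht
  have hd : a - s * x (n + 1) ∈ J := by
    refine hJ _ ?_
    have : (a - s * x (n + 1)) ^ p =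
        j - p * ((a - s * x (n + 1)) * (s * x (n + 1)) * t) := by linear_combination -ht
    rw [this]
    exact sub_mem hj (J.mul_mem_right _ hpJ)
  rw [← sub_add_cancel a (s * x (n + 1))]
  exact add_mem (Ideal.mem_sup_left hd)
    (Ideal.mem_sup_right (Ideal.mul_mem_left _ _ (Ideal.subset_span ⟨n + 1, rfl⟩)))

lemma Ideal.span_range_le_of_isPrime {q : ℕ} {x : ℕ → B} (hx : ∀ n, x (n + 1) ^ q = x n)
    {P : Ideal B} [P.IsPrime] (h : x 0 ∈ P) : Ideal.span (Set.range x) ≤ P := by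
  rw [Ideal.span_le]
  rintro _ ⟨n, rfl⟩
  exact Ideal.IsPrime.mem_of_pow_mem inferInstance (q ^ n) (iterated_root_sequence_pow hx n ▸ h)

/-- Enlarge the exponent `n` to `p ^ n` and extract `p`-th roots `n` times. -/
lemma Ideal.isRadical_of_pow_mem (hp : p.Prime) {J : Ideal B} (hJ : ∀ a, a ^ p ∈ J → a ∈ J) :
    J.IsRadical := by
  rintro a ⟨n, hn⟩
  have h : ∀ k, a ^ p ^ k ∈ J → a ∈ J := fun k => by
    induction k with
    | zero => simp
    | succ k ih => exact fun h => ih (hJ _ (by rwa [← pow_mul, ← pow_succ]))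
  exact h n (J.mem_of_dvd (pow_dvd_pow a (Nat.lt_pow_self hp.one_lt).le) hn)

/-- Adding all `p`-power roots of finitely many elements to an ideal. -/
lemma Ideal.exists_isRadical_hasProjectiveDimensionLT (hp : p.Prime)
    (hroot : ∀ a : B, ∃ b, b ^ p = a) {J : Ideal B} (hpJ : (p : B) ∈ J)
    (hJ : ∀ a, a ^ p ∈ J → a ∈ J) {n : ℕ}
    (hn : HasProjectiveDimensionLT (ModuleCat.of B (B ⧸ J)) n) (s : Finset B) :
    ∃ J' : Ideal B, J ≤ J' ∧ ↑s ⊆ (J' : Set B) ∧ J'.IsRadical ∧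
      (∀ P : Ideal B, P.IsPrime → J ≤ P → ↑s ⊆ (P : Set B) → J' ≤ P) ∧
      HasProjectiveDimensionLT (ModuleCat.of B (B ⧸ J')) (n + 2 * s.card) := by
  classical
  -- The induction has to carry closure under `p`-th roots; radicality is only drawn from it at the
  -- end.
  suffices ∃ J' : Ideal B, J ≤ J' ∧ ↑s ⊆ (J' : Set B) ∧ (∀ a, a ^ p ∈ J' → a ∈ J') ∧
      (∀ P : Ideal B, P.IsPrime → J ≤ P → ↑s ⊆ (P : Set B) → J' ≤ P) ∧
      HasProjectiveDimensionLT (ModuleCat.of B (B ⧸ J')) (n + 2 * s.card) by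
    obtain ⟨J', h1, h2, h3, h4⟩ := this
    exact ⟨J', h1, h2, Ideal.isRadical_of_pow_mem hp h3, h4⟩
  induction s using Finset.induction_on with
  | empty => exact ⟨J, le_rfl, by simp, hJ, fun P _ h _ => h, hn⟩
  | insert a s ha ih =>
    obtain ⟨J', h1, h2, h3, h4, h5⟩ := ih
    obtain ⟨x, rfl, hx⟩ := exists_iterated_root_sequence hroot a
    refine ⟨J' ⊔ Ideal.span (Set.range x), h1.trans le_sup_left, ?_, fun a ha =>
      Ideal.mem_sup_span_range_of_pow_mem hp hroot (h1 hpJ) h3 hx ha, fun P hP hJP hsP => ?_, ?_⟩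
    · rw [Finset.coe_insert, Set.insert_subset_iff]
      exact ⟨Ideal.mem_sup_right (Ideal.subset_span ⟨0, rfl⟩),
        h2.trans (le_sup_left : J' ≤ J' ⊔ Ideal.span (Set.range x))⟩
    · rw [Finset.coe_insert, Set.insert_subset_iff] at hsP
      exact sup_le (h4 P hP hJP hsP.2) (Ideal.span_range_le_of_isPrime hx hsP.1)
    · rw [Finset.card_insert_of_notMem ha]
      exact Ideal.hasProjectiveDimensionLT_quotient_sup_span_range J' hp.two_le h3 x hx _ h5

end RootClosed

/-- Lifts of a system of parameters of the quotient of a Noetherian local ring. -/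
lemma IsLocalRing.exists_finset_card_le_ringKrullDim_quotient {R : Type*} [CommRing R]
    [IsLocalRing R] [IsNoetherianRing R] {I : Ideal R} (hI : I ≠ ⊤) :
    ∃ s : Finset R, ↑s ⊆ (maximalIdeal R : Set R) ∧
      ((s.card : ℕ∞) : WithBot ℕ∞) ≤ ringKrullDim (R ⧸ I) ∧
      ∀ P : Ideal R, P.IsPrime → I ≤ P → ↑s ⊆ (P : Set R) → P = maximalIdeal R := by
  classical
  have : Nontrivial (R ⧸ I) := Ideal.Quotient.nontrivial_iff.2 hI
  have : IsLocalRing (R ⧸ I) :=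
    IsLocalRing.of_surjective' (Ideal.Quotient.mk I) Ideal.Quotient.mk_surjective
  obtain ⟨t, ht, hcard⟩ :=
    Ideal.exists_finset_card_eq_height_of_isNoetherianRing (maximalIdeal (R ⧸ I))
  have hmk := Function.surjInv_eq (Ideal.Quotient.mk_surjective (I := I))
  have hmax : (maximalIdeal (R ⧸ I)).comap (Ideal.Quotient.mk I) = maximalIdeal R :=
    IsLocalRing.eq_maximalIdeal
      (Ideal.comap_isMaximal_of_surjective _ Ideal.Quotient.mk_surjective)
  refine ⟨t.image (Function.surjInv Ideal.Quotient.mk_surjective), ?_, ?_, fun P hP hIP hs => ?_⟩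
  · intro a ha
    obtain ⟨b, hb, rfl⟩ := Finset.mem_image.1 (Finset.mem_coe.1 ha)
    rw [← hmax, SetLike.mem_coe, Ideal.mem_comap, hmk]
    exact ht.1.2 (Ideal.subset_span hb)
  · rw [← IsLocalRing.maximalIdeal_height_eq_ringKrullDim, ← hcard]
    exact_mod_cast Finset.card_image_le
  -- The maximal ideal of `R ⧸ I` is minimal over the span of `t`, so the image of `P`, a prime
  -- containing `t`, must be all of it.
  · have hP' := Ideal.isPrime_map_quotientMk_of_isPrime hIP
    have h1 : maximalIdeal (R ⧸ I) ≤ P.map (Ideal.Quotient.mk I) := by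
      refine ht.2 ⟨hP', Ideal.span_le.2 fun b hb => ?_⟩ (IsLocalRing.le_maximalIdeal hP'.ne_top)
      rw [← hmk b]
      exact Ideal.mem_map_of_mem _ (hs (Finset.mem_coe.2 (Finset.mem_image_of_mem _ hb)))
    refine le_antisymm (IsLocalRing.le_maximalIdeal hP.ne_top) ?_
    rw [← hmax]
    refine (Ideal.comap_mono h1).trans ?_
    rw [Ideal.comap_map_of_surjective _ Ideal.Quotient.mk_surjective, ← RingHom.ker_eq_comap_bot,
      Ideal.mk_ker, sup_eq_left.2 hIP]

namespace AbsoluteIntegralClosure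

variable {R : Type u} [CommRing R] [IsDomain R]

set_option synthInstance.maxHeartbeats 200000 in
/-- The ideal generated by all `p`-power roots of `p` is closed under `p`-th roots, and the
quotient by it has projective dimension at most `2 * k` for some `k` with
`dim (R / p) + k ≤ dim R`. -/
lemma exists_rootClosed_ideal {p : ℕ} (hp : p.Prime) :
    ∃ (J : Ideal (AbsoluteIntegralClosure R)) (k : ℕ),
      (p : AbsoluteIntegralClosure R) ∈ J ∧ (∀ a, a ^ p ∈ J → a ∈ J) ∧
      (∀ P : Ideal (AbsoluteIntegralClosure R), P.IsPrime →
        (p : AbsoluteIntegralClosure R) ∈ P → J ≤ P) ∧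
      HasProjectiveDimensionLT (ModuleCat.of (AbsoluteIntegralClosure R)
        (AbsoluteIntegralClosure R ⧸ J)) (2 * k + 1) ∧
      ringKrullDim (R ⧸ Ideal.span {(p : R)}) + k ≤ ringKrullDim R := by
  have hbot : ∀ a : AbsoluteIntegralClosure R,
      a ^ p ∈ (⊥ : Ideal (AbsoluteIntegralClosure R)) →
      a ∈ (⊥ : Ideal (AbsoluteIntegralClosure R)) := fun a ha => eq_zero_of_pow_eq_zero ha
  -- In equal characteristic nothing is adjoined and `k = 0`. Otherwise `p` is a nonzerodivisor, and
  -- the drop of `dim (R ⧸ p)` by one pays for the two dimensions that its roots cost.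
  by_cases hp0 : (p : R) = 0
  · have hpB : (p : AbsoluteIntegralClosure R) = 0 := by
      rw [← map_natCast (algebraMap R (AbsoluteIntegralClosure R)), hp0, map_zero]
    refine ⟨⊥, 0, hpB ▸ zero_mem _, hbot, fun P _ _ => bot_le,
      Ideal.hasProjectiveDimensionLT_one_quotient_bot _, ?_⟩
    rw [Nat.cast_zero, add_zero]
    exact ringKrullDim_quotient_le _
  · obtain ⟨x, hx0, hx⟩ := exists_iterated_root_sequence (fun a => exists_root a hp.pos)
      (p : AbsoluteIntegralClosure R)
    refine ⟨⊥ ⊔ Ideal.span (Set.range x), 1,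
      Ideal.mem_sup_right (Ideal.subset_span ⟨0, hx0⟩), fun a ha => ?_, fun P hP hpP =>
      sup_le bot_le (Ideal.span_range_le_of_isPrime hx (hx0 ▸ hpP)),
      Ideal.hasProjectiveDimensionLT_quotient_sup_span_range ⊥ hp.two_le hbot x hx 1
      (Ideal.hasProjectiveDimensionLT_one_quotient_bot _),
      ringKrullDim_quotient_succ_le_of_nonZeroDivisor (mem_nonZeroDivisors_of_ne_zero hp0)⟩
    -- The Frobenius argument is not available over the zero ideal, which does not contain `p`.
    -- Instead `a ^ p` is the `p`-th power of `s * x (n + 1)`, and in `R⁺` elements with equal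
    -- `p`-th powers divide each other.
    rw [bot_sup_eq] at ha ⊢
    obtain ⟨n, r, hr⟩ := Ideal.exists_eq_mul_of_mem_span_range
      (fun n => hx n ▸ dvd_pow_self _ hp.ne_zero) ha
    obtain ⟨s, rfl⟩ := exists_root r hp.pos
    rw [← hx n, ← mul_pow] at hr
    exact Ideal.mem_of_dvd _ (root_dvd_root hp.pos le_rfl hr.symm)
      (Ideal.mul_mem_left _ _ (Ideal.subset_span ⟨n + 1, rfl⟩))

end AbsoluteIntegralClosure

lemma torsionTheoryGR_isDefinedBy (R : Type u) [CommRing R] [IsDomain R]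
    [IsLocalRing (AbsoluteIntegralClosure R)] :
    (torsionTheoryGR R).IsDefinedBy fun I =>
      IsLocalRing.maximalIdeal (AbsoluteIntegralClosure R) ≤ I :=
  TorsionTheory.ofFilter_isDefinedBy ..

open AbsoluteIntegralClosure in
theorem torsionTheoryGR_cd_le (R : Type u) [CommRing R] [IsDomain R] [IsLocalRing R]
    [IsLocalRing (AbsoluteIntegralClosure R)] [IsNoetherianRing R] {p : ℕ} (hp : p.Prime)
    [CharP (IsLocalRing.ResidueField R) p] :
    (torsionTheoryGR R).cd ≤ 2 * ringKrullDim R := by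
  classical
  have hpm : (p : R) ∈ IsLocalRing.maximalIdeal R := by
    rw [← IsLocalRing.residue_eq_zero_iff, map_natCast, CharP.cast_eq_zero]
  have hcomap : ∀ P : Ideal (AbsoluteIntegralClosure R),
      P.comap (algebraMap R (AbsoluteIntegralClosure R)) = IsLocalRing.maximalIdeal R →
      ∀ [P.IsPrime], P = IsLocalRing.maximalIdeal _ := fun P h _ =>
    IsLocalRing.eq_maximalIdeal (Ideal.isMaximal_of_isIntegral_of_isMaximal_comap P
      (h ▸ IsLocalRing.maximalIdeal.isMaximal R))
  have hmax : (IsLocalRing.maximalIdeal (AbsoluteIntegralClosure R)).comap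
      (algebraMap R (AbsoluteIntegralClosure R)) = IsLocalRing.maximalIdeal R :=
    IsLocalRing.eq_maximalIdeal (Ideal.isMaximal_comap_of_isIntegral_of_isMaximal _)
  obtain ⟨s, hsm, hs, hsP⟩ := IsLocalRing.exists_finset_card_le_ringKrullDim_quotient
    (I := Ideal.span {(p : R)}) (((Ideal.span_singleton_le_iff_mem _).2 hpm).trans_lt
      (lt_top_iff_ne_top.2 (IsLocalRing.maximalIdeal.isMaximal R).ne_top)).ne
  obtain ⟨J, k, hpJ, hJ, hJP, hdim, hk⟩ := exists_rootClosed_ideal (R := R) hp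
  obtain ⟨J', hJJ', hsJ', hrad, hmin, hdim'⟩ := Ideal.exists_isRadical_hasProjectiveDimensionLT hp
    (fun a => exists_root a hp.pos) hpJ hJ hdim
    (s.image (algebraMap R (AbsoluteIntegralClosure R)))
  -- A prime over `J'` contracts to a prime of `R` containing `p` and `s`, that is, to the maximal
  -- ideal; by integrality it is itself maximal. So the radical ideal `J'` is an intersection of
  -- copies of the maximal ideal.
  have hJ'm : J' = IsLocalRing.maximalIdeal (AbsoluteIntegralClosure R) := by
    refine le_antisymm (hmin _ inferInstance (hJP _ inferInstance ?_) ?_) ?_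
    · rw [← map_natCast (algebraMap R (AbsoluteIntegralClosure R)), ← Ideal.mem_comap, hmax]
      exact hpm
    · intro b hb
      obtain ⟨a, ha, rfl⟩ := Finset.mem_image.1 (Finset.mem_coe.1 hb)
      rw [SetLike.mem_coe, ← Ideal.mem_comap, hmax]
      exact hsm ha
    · rw [← hrad.radical, Ideal.radical_eq_sInf]
      refine le_sInf fun P hP => ?_
      have := hP.2
      refine (hcomap P (hsP _ inferInstance ?_ fun a ha => ?_)).ge
      · rw [Ideal.span_singleton_le_iff_mem, Ideal.mem_comap, map_natCast]
        exact hP.1 (hJJ' hpJ)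
      · exact hP.1 (hsJ' (Finset.mem_coe.2 (Finset.mem_image_of_mem _ ha)))
  subst hJ'm
  -- The bound `2 * (s.card + k)` is at most twice `dim R`, because `s.card ≤ dim (R ⧸ p)` and `dim
  -- (R ⧸ p) + k ≤ dim R`.
  refine ((torsionTheoryGR_isDefinedBy R).cd_le_of_hasProjectiveDimensionLT le_rfl
    (fun _ h => h) (2 * (s.card + k)) ?_).trans ?_
  · refine hasProjectiveDimensionLT_of_ge _ 
      (2 * k + 1 + 2 * (s.image (algebraMap R (AbsoluteIntegralClosure R))).card) _ ?_
    have : (s.image (algebraMap R (AbsoluteIntegralClosure R))).card ≤ s.card :=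
      Finset.card_image_le
    omega
  · have h : ((s.card + k : ℕ) : WithBot ℕ∞) ≤ ringKrullDim R := by
      push_cast
      exact (add_le_add_left hs _).trans hk
    calc (((2 * (s.card + k) : ℕ) : ℕ∞) : WithBot ℕ∞)
        = 2 * ((s.card + k : ℕ) : WithBot ℕ∞) := by push_cast; rfl
      _ ≤ 2 * ringKrullDim R := by gcongr

theorem proposition6p3 (R : Type u) [CommRing R] [IsDomain R] [HenselianLocalRing R] :
    ∃ _ : IsLocalRing (AbsoluteIntegralClosure R),
      (∀ p : ℕ, p.Prime → CharP (IsLocalRing.ResidueField R) p → IsNoetherianRing R →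
        (torsionTheoryGR R).cd ≤ 2 * ringKrullDim R) ∧
      (∀ x ∈ IsLocalRing.maximalIdeal (AbsoluteIntegralClosure R), x ≠ 0 →
        (torsionTheoryOfElement x).cd = 2) ∧
      (∀ v : AddValuation (AbsoluteIntegralClosure R) (WithTop ℚ),
        (∀ a, 0 ≤ v a) →
        (∀ a ∈ IsLocalRing.maximalIdeal (AbsoluteIntegralClosure R), 0 < v a) →
        (∀ i : ℕ, Nonempty ((torsionTheoryOfValuation v).derived i ≅
          colimit (localCohomologySystem (torsionTheoryOfValuation v).gabriel i))) ∧
        (torsionTheoryOfValuation v).cd ≤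
          sSup {d : WithBot ℕ∞ | ∃ I ∈ (torsionTheoryOfValuation v).gabriel,
            d = cohomologicalDimension (localCohomology I)}) := by
  refine ⟨AbsoluteIntegralClosure.isLocalRing R, fun p hp _ _ => torsionTheoryGR_cd_le R hp,
    fun x hx hx0 => torsionTheoryOfElement_cd hx hx0, fun v _ _ => ?_⟩
  have hT : (torsionTheoryOfValuation v).IsDefinedBy fun I =>
      ∀ ε : ℚ, 0 < ε → ∃ a ∈ I, v a < (ε : WithTop ℚ) :=
    TorsionTheory.ofFilter_isDefinedBy ..
  exact ⟨hT.derived_iso_colimit_localCohomology, hT.cd_le_sSup_localCohomology⟩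

end
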